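/- **Game.** Let $\Omega_x=[x_{\min},x_{\max}]$ with $x_{\min}<x_{\max}$, $\Omega_y=[y_{\min},y_{\max}]\neq\emptyset$, $\Omega_z=\prod_{i=1}^N[z_{i,\min},z_{i,\max}]\subset\mathbb R^N$ nonempty, $\Omega=\Omega_x\times\Omega_y\times\Omega_z$, let $\Theta\subset\mathbb R^m$ be finite and nonempty and $\theta_0\in\mathbb R^m$. The utilities are $U_X(x,y,z)=B(x,\theta_0)+f_1(y,z)\,x$, $\;U_Y(x,y,\theta)=f_2(x,\theta)y+f_3(x)$, $\;U_{Z_i}(x,y,z,\theta)=f_{4,i}(x,y,z,\theta)$ $(i\le N)$. $\mathrm{BR}_Z(x,y,\theta)\subseteq\Omega_z$ is the set of Nash equilibria of the game among $Z_1,\dots,Z_N$ (player $i$ choosing $z_i\in[z_{i,\min},z_{i,\max}]$ to maximize $U_{Z_i}$), $\mathrm{BR}_Y(x,\theta)=\arg\max_{y\in\Omega_y}U_Y(x,y,\theta)$, and $\underline U(x,\theta)=\min_{y\in\mathrm{BR}_Y(x,\theta)}\min_{z\in\mathrm{BR}_Z(x,y,\theta)}U_X(x,y,z)$. For $\epsilon>0$,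 $(x^*,y^*,z^*,\theta^*)$ is an *$\epsilon$-WDSE* if $x^*\in\Omega_x$, $\theta^*\in\Theta$, $y^*\in\mathrm{BR}_Y(x^*,\theta^*)$, $z^*\in\mathrm{BR}_Z(x^*,y^*,\theta^*)$, $U_X(x^*,y^*,z^*)=\underline U(x^*,\theta^*)$, and $\underline U(x^*,\theta^*)\ge\underline U(x,\theta)-\epsilon$ for all $x\in\Omega_x$, $\theta\in\Theta$. **Assumptions.** Put $F(x,y,z,\theta)=(-\partial_{z_i}f_{4,i}(x,y,z,\theta))_{i\le N}$. "$C^1$" means continuously differentiable in a neighbourhood of each point of the strategy sets, for each fixed $\theta\in\Theta$; $\|\cdot\|$ is Euclidean. Below, $x\in\Omega_x$, $y\in\Omega_y$, $z,z'\in\Omega_z$, $\theta\in\Theta$. (1) $U_X,U_Y,U_{Z_i}$ are $C^1$ and concave in $x$, $y$, $z_i$ respectively. (2) For constants $\mu,\kappa>0$: $\langle F(x,y,z,\theta)-F(x,y,z',\theta),z-z'\rangle\ge\mu\|z-z'\|^2$ and $\|F(x,y,z,\theta)-F(x,y,z',\theta)\|\le\kappa\|z-z'\|$; and $F(\cdot,\cdot,\cdot,\theta)$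 is $C^1$. (Then $\mathrm{BR}_Z(x,y,\theta)$ is a singleton, also written as a point.) (3) $\nabla_xB(\cdot,\theta_0)$ is Lipschitz on $\Omega_x$; $\nabla_zf_1(y,\cdot)$ is Lipschitz on $\Omega_z$ with a constant independent of $y$; $f_2(\cdot,\theta)$ has finitely many zeros in $\Omega_x$; $F(\cdot,\cdot,\cdot,\theta)|_\Omega$ is definable in an o-minimal structure expanding the real field; the partial Jacobians $\mathrm J_xF$ and $\mathrm J_zF$ are Lipschitz in $z\in\Omega_z$, with a constant independent of $x,y,\theta$. (4) For each $y$ and $\theta$, $x\mapsto U_X(x,y,\mathrm{BR}_Z(x,y,\theta))$ is concave on each closed interval between consecutive points of $\{x_{\min},x_{\max}\}\cup\{\text{zeros of }f_2(\cdot,\theta)\text{ in }\Omega_x\}$. **Enclosures.** For $\theta\in\Theta$ let $x_{1}<\dots<x_{q_\theta}$ be the zeros of $f_2(\cdot,\theta)$ in $\Omega_x$, and let $I_{j,\theta}=[a_j,b_j]\subseteq\Omega_x$ be closed intervals such that $x_j$ lies in the interior of $I_{j,\theta}$ relative to $\Omega_x$. With $b_0=x_{\min}$ and $a_{q_\theta+1}=x_{\max}$,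 the *certainty intervals* are the $[b_{i},a_{i+1}]$, $0\le i\le q_\theta$, with $b_i<a_{i+1}$. **Algorithm 1.** Parameters: $0<\gamma<2\mu/\kappa^2$; $\eta=\sqrt{1-\gamma(2\mu-\gamma\kappa^2)}$ (read as $0$ if the radicand is negative); step sizes $\alpha^k\ge0$ with $\sum_k\alpha^k=\infty$ and $\sum_k(\alpha^k)^2<\infty$; tolerances $\sigma^k>0$ with $\sum_k\alpha^k\sigma^k<\infty$. Let $\phi_1(x)=y_{\max}$ if $f_2(x,\theta)>0$ and $\phi_1(x)=y_{\min}$ otherwise, $\omega(x,y,z)=z-\gamma F(x,y,z,\theta)$, and $h(x,y,z)=\mathbb P_{\Omega_z}[\omega(x,y,z)]$. For every $\theta\in\Theta$ and every certainty interval $[b,a]$, start from arbitrary $x^0\in[b,a]$, $z^0\in\Omega_z$, $s^0\in\mathbb R^N$. Given $(x^k,z^k,s^k)$, put $y=\phi_1(x^k)$ and run the inner loop: (i) iterate $z\leftarrow h(x^k,y,z)$ from $z^k$, at least once, until two successive iterates differ by at most $\sigma^k$ in norm, and let $\tilde z^0$ be the last iterate; (ii) put $\tilde s^0=s^k$, $\tilde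 z^{\ell+1}=h(x^k,y,\tilde z^\ell)$, $\tilde s^{\ell+1}=\mathrm J_xh(x^k,y,\tilde z^{\ell+1})+\mathrm J_zh(x^k,y,\tilde z^{\ell+1})\tilde s^\ell$ (a partial Jacobian being read as $0$ where it does not exist), stop at the first $\ell\ge1$ with $\max\{\eta^\ell,\sum_{j=0}^\ell\eta^{\ell-j}\|\tilde z^{j+1}-\tilde z^j\|\}\le\sigma^k$, and let $(z^{k+1},s^{k+1})=(\tilde z^\ell,\tilde s^\ell)$. Then set $x^{k+1}=\mathbb P_{[b,a]}\big[x^k+\alpha^k\big(\partial_xU_X(x^k,y,z^{k+1})+\nabla_zU_X(x^k,y,z^{k+1})^{\top}s^{k+1}\big)\big]$. The candidates for $\theta$ are the limits $\bar x=\lim_kx^k$ on the certainty intervals, with recorded utility $U_X(\bar x,\phi_1(\bar x),\mathrm{BR}_Z(\bar x,\phi_1(\bar x),\theta))$, and, for each $j$, an arbitrarily chosen point $p_{j,\theta}\in I_{j,\theta}$, with recorded utility $\inf_{y\in\Omega_y}U_X(p_{j,\theta},y,\mathrm{BR}_Z(p_{j,\theta},y,\theta))$. The algorithm returns a pair $(x^*,\theta^*)$,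 $x^*$ a candidate for $\theta^*$, with largest recorded utility among all candidates for all $\theta\in\Theta$. **Conditions on the iterates.** Space $\mathbb R^N$ is the union of $3^N$ closed boxes, obtained by splitting each coordinate axis into $(-\infty,z_{i,\min}]$, $[z_{i,\min},z_{i,\max}]$, $[z_{i,\max},\infty)$. Let $\omega^*(x)=\omega(x,\phi_1(x),\mathrm{BR}_Z(x,\phi_1(x),\theta))$, let $\mathcal P(x)$ be the set of those boxes that contain $\omega^*(x)$, and let $\delta(x)\in[0,\infty]$ be the supremum of the radii of closed balls around $\omega^*(x)$ contained in the union of the boxes in $\mathcal P(x)$. (5) On each certainty interval there is $k'$ with $\sigma^k<\delta(x^k)$ for all $k>k'$. (6) On each certainty interval $\mathcal P(x^k)$ is a singleton for all but finitely many $k$. **Theorem (convergence to $\epsilon$-WDSE with approximate zeros).** Under (1)–(4) there is a constant $L>0$, depending only on the game, such that for every $\epsilon>0$, all enclosures with Lebesgue measure $\lambda(I_{j,\theta})\le\epsilon/L$ for all $j$ and $\theta$, and all choices of the parameters, starting points and points $p_{j,\theta}$ for which (5) and (6) hold, Algorithm 1 converges to an $\epsilon$-WDSE strategy: all inner loops terminate,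 the iterates $x^k$ converge on every certainty interval, a pair $(x^*,\theta^*)$ of largest recorded utility exists, and for every such pair there are $y^*,z^*$ such that $(x^*,y^*,z^*,\theta^*)$ is an $\epsilon$-WDSE. -/

import Mathlib

open scoped NNReal ENNReal

noncomputable section

namespace Deception

/-! ### Definability -/

/-- An o-minimal structure expanding the real field. -/
structure OMinimalStructure where
  /-- the definable subsets of `ℝⁿ` -/
  Def : (n : ℕ) → Set (Set (Fin n → ℝ))
  compl_mem : ∀ {n : ℕ} {A : Set (Fin n → ℝ)}, A ∈ Def n → Aᶜ ∈ Def n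
  union_mem : ∀ {n : ℕ} {A A' : Set (Fin n → ℝ)}, A ∈ Def n → A' ∈ Def n → A ∪ A' ∈ Def n
  prod_left_mem : ∀ {n : ℕ} {A : Set (Fin n → ℝ)}, A ∈ Def n →
    {v : Fin (n + 1) → ℝ | Fin.tail v ∈ A} ∈ Def (n + 1)
  prod_right_mem : ∀ {n : ℕ} {A : Set (Fin n → ℝ)}, A ∈ Def n →
    {v : Fin (n + 1) → ℝ | Fin.init v ∈ A} ∈ Def (n + 1)
  proj_mem : ∀ {n : ℕ} {A : Set (Fin (n + 1) → ℝ)}, A ∈ Def (n + 1) →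
    (fun v : Fin (n + 1) → ℝ => (Fin.init v : Fin n → ℝ)) '' A ∈ Def n
  algebraic_mem : ∀ {n : ℕ} (p : MvPolynomial (Fin n) ℝ),
    {v : Fin n → ℝ | MvPolynomial.eval v p = 0} ∈ Def n
  /-- Definable subsets of the line are finite unions of points and intervals
  (equivalently, their frontier is finite). -/
  o_minimal : ∀ {A : Set (Fin 1 → ℝ)}, A ∈ Def 1 →
    (frontier {t : ℝ | (fun _ => t) ∈ A}).Finite

/-! ### The game -/

/-- Profiles of the `N` bottom-level followers. -/
abbrev Prof (N : ℕ) := EuclideanSpace ℝ (Fin N)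

/-- Parameters. -/
abbrev Par (m : ℕ) := EuclideanSpace ℝ (Fin m)

/-- The data of a three-party deception game. -/
structure Game (m N : ℕ) where
  xmin : ℝ
  xmax : ℝ
  ymin : ℝ
  ymax : ℝ
  zmin : Fin N → ℝ
  zmax : Fin N → ℝ
  hx : xmin < xmax
  hy : ymin ≤ ymax
  hz : ∀ i, zmin i ≤ zmax i
  /-- the true parameter -/
  θ₀ : Par m
  /-- the finite set of deception parameters -/
  Θ : Finset (Par m)
  hΘ : Θ.Nonempty
  B : ℝ → Par m → ℝ
  f₁ : ℝ → Prof N → ℝ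
  f₂ : ℝ → Par m → ℝ
  f₃ : ℝ → ℝ
  f₄ : Fin N → ℝ → ℝ → Prof N → Par m → ℝ

/-- The profile `z` with its `i`-th entry replaced by `t`, that is `(t, z₋ᵢ)`. -/
def setCoord {N : ℕ} (z : Prof N) (i : Fin N) (t : ℝ) : Prof N :=
  WithLp.toLp 2 (Function.update (fun j => z j) i t)

namespace Game

variable {m N : ℕ} (G : Game m N)

/-- The strategy set of the leader. -/
def Ωx : Set ℝ := Set.Icc G.xmin G.xmax

/-- The strategy set of the middle-level follower. -/
def Ωy : Set ℝ := Set.Icc G.ymin G.ymax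

/-- The strategy set of the bottom-level followers. -/
def Ωz : Set (Prof N) := {z | ∀ i, z i ∈ Set.Icc (G.zmin i) (G.zmax i)}

/-- The leader's utility, under the true parameter. -/
def UX (x y : ℝ) (z : Prof N) : ℝ := G.B x G.θ₀ + G.f₁ y z * x

/-- The middle-level follower's utility. -/
def UY (x y : ℝ) (θ : Par m) : ℝ := G.f₂ x θ * y + G.f₃ x

/-- Best responses of the bottom level: the Nash equilibria of the bottom-level game. -/
def BRZ (x y : ℝ) (θ : Par m) : Set (Prof N) :=
  {z | z ∈ G.Ωz ∧ ∀ i, ∀ t ∈ Set.Icc (G.zmin i) (G.zmax i),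
    G.f₄ i x y (setCoord z i t) θ ≤ G.f₄ i x y z θ}

/-- Best responses of the middle level. -/
def BRY (x : ℝ) (θ : Par m) : Set ℝ :=
  {y | y ∈ G.Ωy ∧ ∀ y' ∈ G.Ωy, G.UY x y' θ ≤ G.UY x y θ}

/-- The leader's utility when the followers choose the best responses that are worst
for the leader. -/
def worst (x : ℝ) (θ : Par m) : ℝ :=
  sInf {u | ∃ y ∈ G.BRY x θ, ∃ z ∈ G.BRZ x y θ, u = G.UX x y z}

/-- An `ε`-weak deception Stackelberg equilibrium: `(y, z)` are best responses attaining the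
pessimistic minimum at `(x, θ)`, and no `(x', θ')` has a pessimistic utility exceeding that of
`(x, θ)` by more than `ε`. -/
structure IsEpsWDSE (ε : ℝ) (x y : ℝ) (z : Prof N) (θ : Par m) : Prop where
  x_mem : x ∈ G.Ωx
  θ_mem : θ ∈ G.Θ
  y_mem : y ∈ G.BRY x θ
  z_mem : z ∈ G.BRZ x y θ
  attains : G.UX x y z = G.worst x θ
  eps_opt : ∀ θ' ∈ G.Θ, ∀ x' ∈ G.Ωx, G.worst x' θ' - ε ≤ G.worst x θ

/-- The pseudogradient of the bottom-level game, `(-∂f₄ᵢ/∂zᵢ)ᵢ`. -/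
def F (x y : ℝ) (z : Prof N) (θ : Par m) : Prof N :=
  WithLp.toLp 2 fun i => -deriv (fun t => G.f₄ i x y (setCoord z i t) θ) (z i)

/-- The zeros of `f₂(·, θ)` in the leader's strategy set. -/
def zeroSet (θ : Par m) : Set ℝ := {x | x ∈ G.Ωx ∧ G.f₂ x θ = 0}

/-- The equilibrium of the bottom-level game (unique under the assumptions below). -/
def brZ (x y : ℝ) (θ : Par m) : Prof N :=
  Classical.epsilon fun z => z ∈ G.BRZ x y θ

/-- The leader's utility at `(x, y)` once the bottom level responds. -/
def Ured (x y : ℝ) (θ : Par m) : ℝ := G.UX x y (G.brZ x y θ)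

/-! ### Standing assumptions

A function is called continuously differentiable on a (possibly lower-dimensional) compact set of
strategies if it is so in a neighbourhood of each of its points. -/

/-- Concave, continuously differentiable utilities. -/
structure ConcaveSmooth : Prop where
  UX_concave : ∀ y ∈ G.Ωy, ∀ z ∈ G.Ωz, ConcaveOn ℝ G.Ωx fun x => G.UX x y z
  UY_concave : ∀ θ ∈ G.Θ, ∀ x ∈ G.Ωx, ConcaveOn ℝ G.Ωy fun y => G.UY x y θ
  UZ_concave : ∀ θ ∈ G.Θ, ∀ x ∈ G.Ωx, ∀ y ∈ G.Ωy, ∀ z ∈ G.Ωz, ∀ i,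
    ConcaveOn ℝ (Set.Icc (G.zmin i) (G.zmax i)) fun t => G.f₄ i x y (setCoord z i t) θ
  UX_smooth : ∀ x ∈ G.Ωx, ∀ y ∈ G.Ωy, ∀ z ∈ G.Ωz,
    ContDiffAt ℝ 1 (fun p : ℝ × ℝ × Prof N => G.UX p.1 p.2.1 p.2.2) (x, y, z)
  UY_smooth : ∀ θ ∈ G.Θ, ∀ x ∈ G.Ωx, ∀ y ∈ G.Ωy,
    ContDiffAt ℝ 1 (fun p : ℝ × ℝ => G.UY p.1 p.2 θ) (x, y)
  UZ_smooth : ∀ θ ∈ G.Θ, ∀ x ∈ G.Ωx, ∀ y ∈ G.Ωy, ∀ z ∈ G.Ωz, ∀ i,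
    ContDiffAt ℝ 1 (fun p : ℝ × ℝ × Prof N => G.f₄ i p.1 p.2.1 p.2.2 θ) (x, y, z)

/-- Strong monotonicity, Lipschitz continuity and smoothness of the pseudogradient. -/
structure StronglyMonotone (μ κ : ℝ) : Prop where
  μ_pos : 0 < μ
  κ_pos : 0 < κ
  monotone : ∀ θ ∈ G.Θ, ∀ x ∈ G.Ωx, ∀ y ∈ G.Ωy, ∀ z ∈ G.Ωz, ∀ z' ∈ G.Ωz,
    μ * ‖z - z'‖ ^ 2 ≤ inner ℝ (G.F x y z θ - G.F x y z' θ) (z - z')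
  lipschitz : ∀ θ ∈ G.Θ, ∀ x ∈ G.Ωx, ∀ y ∈ G.Ωy, ∀ z ∈ G.Ωz, ∀ z' ∈ G.Ωz,
    ‖G.F x y z θ - G.F x y z' θ‖ ≤ κ * ‖z - z'‖
  smooth : ∀ θ ∈ G.Θ, ∀ x ∈ G.Ωx, ∀ y ∈ G.Ωy, ∀ z ∈ G.Ωz,
    ContDiffAt ℝ 1 (fun p : ℝ × ℝ × Prof N => G.F p.1 p.2.1 p.2.2 θ) (x, y, z)

/-- The graph of `F(·, ·, ·, θ)` over the strategy sets, as a subset of `ℝ²⁺ᴺ⁺ᴺ`. -/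
def graphF (θ : Par m) : Set (Fin (2 + N + N) → ℝ) :=
  {v | ∃ x ∈ G.Ωx, ∃ y ∈ G.Ωy, ∃ z ∈ G.Ωz,
    v = Fin.append (Fin.append ![x, y] fun i => z i) fun i => G.F x y z θ i}

/-- Lipschitz gradients, finitely many zeros of `f₂(·, θ)`, definable pseudogradient with
Lipschitz partial Jacobians. -/
structure Regular : Prop where
  B_lipschitz : ∃ K : ℝ≥0, LipschitzOnWith K (deriv fun x => G.B x G.θ₀) G.Ωx
  f₁_lipschitz : ∃ K : ℝ≥0, ∀ y ∈ G.Ωy, LipschitzOnWith K (fderiv ℝ (G.f₁ y)) G.Ωz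
  zeros_finite : ∀ θ ∈ G.Θ, (G.zeroSet θ).Finite
  F_definable : ∀ θ ∈ G.Θ, ∃ S : OMinimalStructure, G.graphF θ ∈ S.Def (2 + N + N)
  F_jacobian : ∃ LF : ℝ, ∀ θ ∈ G.Θ, ∀ x ∈ G.Ωx, ∀ y ∈ G.Ωy, ∀ z ∈ G.Ωz, ∀ z' ∈ G.Ωz,
    ‖deriv (fun x' => G.F x' y z θ) x - deriv (fun x' => G.F x' y z' θ) x‖ ≤ LF * ‖z - z'‖ ∧
    ‖fderiv ℝ (fun w => G.F x y w θ) z - fderiv ℝ (fun w => G.F x y w θ) z'‖ ≤ LF * ‖z - z'‖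

/-- For fixed `y` and `θ`, the leader's reduced utility is concave between any two consecutive
points of `{xmin, xmax} ∪ {zeros of f₂(·, θ)}`. -/
def ReducedConcave : Prop :=
  ∀ θ ∈ G.Θ, ∀ y ∈ G.Ωy, ∀ a ∈ {G.xmin, G.xmax} ∪ G.zeroSet θ,
    ∀ b ∈ {G.xmin, G.xmax} ∪ G.zeroSet θ, a < b → (∀ t ∈ Set.Ioo a b, G.f₂ t θ ≠ 0) →
      ConcaveOn ℝ (Set.Icc a b) fun x => G.Ured x y θ

/-! ### Enclosures of the zeros -/

/-- The zeros `zero 0 < zero 1 < ⋯` of `f₂(·, θ)` together with closed intervals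
`[lo j, hi j] ⊆ Ωx`, the `j`-th of which contains the `j`-th zero in its interior relative to
`Ωx`. -/
structure Enclosure (θ : Par m) where
  q : ℕ
  zero : Fin q → ℝ
  zero_mono : StrictMono zero
  range_zero : Set.range zero = G.zeroSet θ
  lo : Fin q → ℝ
  hi : Fin q → ℝ
  subset : ∀ j, Set.Icc (lo j) (hi j) ⊆ G.Ωx
  lo_le : ∀ j, lo j ≤ zero j
  le_hi : ∀ j, zero j ≤ hi j
  lo_lt : ∀ j, zero j ≠ G.xmin → lo j < zero j
  lt_hi : ∀ j, zero j ≠ G.xmax → zero j < hi j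

variable {G}

namespace Enclosure

variable {θ : Par m} (E : G.Enclosure θ)

/-- The interval enclosing the `j`-th zero. -/
def I (j : Fin E.q) : Set ℝ := Set.Icc (E.lo j) (E.hi j)

/-- Left endpoint of the `i`-th certainty interval: `xmin`, or the right endpoint of the preceding
enclosing interval. -/
def left (i : Fin (E.q + 1)) : ℝ := Fin.cons (α := fun _ => ℝ) G.xmin E.hi i

/-- Right endpoint of the `i`-th certainty interval: the left endpoint of the following enclosing
interval, or `xmax`. -/
def right (i : Fin (E.q + 1)) : ℝ := Fin.snoc (α := fun _ => ℝ) E.lo G.xmax i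

end Enclosure

variable (G)

/-! ### The inner loop -/

/-- The response of the middle level where `f₂(·, θ)` does not vanish. -/
def phi₁ (x : ℝ) (θ : Par m) : ℝ := if 0 < G.f₂ x θ then G.ymax else G.ymin

/-- Projection onto the box `Ωz`. -/
def projZ (w : Prof N) : Prof N :=
  WithLp.toLp 2 fun i => max (G.zmin i) (min (G.zmax i) (w i))

/-- The pseudogradient step `ω`. -/
def omega (γ x y : ℝ) (θ : Par m) (z : Prof N) : Prof N := z - γ • G.F x y z θ

/-- The projected pseudogradient step `h`. -/
def h (γ x y : ℝ) (θ : Par m) (z : Prof N) : Prof N := G.projZ (G.omega γ x y θ z)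

/-- The iteration counts `n ≥ 1` at which the warm-start phase (started at `z`) may stop; it is
stopped at the first one. -/
def warmStops (γ x y : ℝ) (θ : Par m) (z : Prof N) (σ : ℝ) : Set ℕ :=
  {n | 1 ≤ n ∧ ‖(G.h γ x y θ)^[n] z - (G.h γ x y θ)^[n - 1] z‖ ≤ σ}

/-- The result of the warm-start phase. -/
def warm (γ x y : ℝ) (θ : Par m) (z : Prof N) (σ : ℝ) : Prof N :=
  (G.h γ x y θ)^[sInf (G.warmStops γ x y θ z σ)] z

/-- The sensitivity iterates of the second phase (started at `z`, `s`). As everywhere in Mathlib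
the (partial) derivatives are `0` by convention at points where `h` is not differentiable. -/
def sens (γ x y : ℝ) (θ : Par m) (z s : Prof N) : ℕ → Prof N
  | 0 => s
  | l + 1 =>
    deriv (fun x' => G.h γ x' y θ ((G.h γ x y θ)^[l + 1] z)) x
      + fderiv ℝ (G.h γ x y θ) ((G.h γ x y θ)^[l + 1] z) (sens γ x y θ z s l)

/-- The iteration counts `l ≥ 1` at which the second phase (started at `z`) may stop; it is stopped
at the first one. -/
def sensStops (η γ x y : ℝ) (θ : Par m) (z : Prof N) (σ : ℝ) : Set ℕ :=
  {l | 1 ≤ l ∧ max (η ^ l) (∑ j ∈ Finset.range (l + 1),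
    η ^ (l - j) * ‖(G.h γ x y θ)^[j + 1] z - (G.h γ x y θ)^[j] z‖) ≤ σ}

/-- Both phases of the inner loop stop. -/
def InnerStops (η γ x y : ℝ) (θ : Par m) (z : Prof N) (σ : ℝ) : Prop :=
  (G.warmStops γ x y θ z σ).Nonempty ∧
    (G.sensStops η γ x y θ (G.warm γ x y θ z σ) σ).Nonempty

/-- The pair `(z, s)` returned by the inner loop. -/
def innerLoop (η γ x y : ℝ) (θ : Par m) (z s : Prof N) (σ : ℝ) : Prof N × Prof N :=
  let z₀ := G.warm γ x y θ z σ
  let l := sInf (G.sensStops η γ x y θ z₀ σ)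
  ((G.h γ x y θ)^[l] z₀, G.sens γ x y θ z₀ s l)

/-- The contraction constant of the projected pseudogradient step. -/
def contr (μ κ γ : ℝ) : ℝ := Real.sqrt (1 - γ * (2 * μ - γ * κ ^ 2))

/-! ### The outer loop -/

/-- The hypergradient computed from the output of the inner loop. -/
def hypergrad (x y : ℝ) (z s : Prof N) : ℝ :=
  deriv (fun x' => G.UX x' y z) x + fderiv ℝ (fun w => G.UX x y w) z s

/-- The current iterates of the outer loop: the leader's strategy, the approximate response of the
bottom level and its approximate sensitivity. (The middle level's response `phi₁ x` is recomputed
in every step.) -/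
structure State (N : ℕ) where
  x : ℝ
  z : Prof N
  s : Prof N

/-- One step of projected hypergradient ascent on `[a, b]`, with step size `α`, tolerance `σ`. -/
def step (η γ : ℝ) (θ : Par m) (a b α σ : ℝ) (c : State N) : State N :=
  let y := G.phi₁ c.x θ
  let p := G.innerLoop η γ c.x y θ c.z c.s σ
  ⟨max a (min b (c.x + α * G.hypergrad c.x y p.1 p.2)), p.1, p.2⟩

/-- The iterates of projected hypergradient ascent on `[a, b]`. -/
def iter (η γ : ℝ) (θ : Par m) (a b : ℝ) (α σ : ℕ → ℝ) (init : State N) : ℕ → State N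
  | 0 => init
  | k + 1 => G.step η γ θ a b (α k) (σ k) (iter η γ θ a b α σ init k)

/-- The part of the real line on which the clamp onto `[zmin i, zmax i]` is given by its
lower constant, identity and upper constant branch, respectively. -/
def branch (i : Fin N) : Fin 3 → Set ℝ :=
  ![Set.Iic (G.zmin i), Set.Icc (G.zmin i) (G.zmax i), Set.Ici (G.zmax i)]

/-- The `3ᴺ` boxes on which the projection onto `Ωz` is affine. -/
def region (c : Fin N → Fin 3) : Set (Prof N) := {w | ∀ i, w i ∈ G.branch i (c i)}

/-- The point `ω(x, φ₁(x), φ₂(x))`. -/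
def omegaStar (γ x : ℝ) (θ : Par m) : Prof N :=
  G.omega γ x (G.phi₁ x θ) θ (G.brZ x (G.phi₁ x θ) θ)

/-- The set `𝒫(x)` of active regions. -/
def active (γ x : ℝ) (θ : Par m) : Set (Fin N → Fin 3) :=
  {c | G.omegaStar γ x θ ∈ G.region c}

/-- The radius `δ(x)` of the largest ball around `ω(x, φ₁(x), φ₂(x))` inside the union of the
active regions (it may be infinite). -/
def radius (γ x : ℝ) (θ : Par m) : ℝ≥0∞ :=
  ⨆ (r : ℝ≥0) (_ : Metric.closedBall (G.omegaStar γ x θ) r ⊆ ⋃ c ∈ G.active γ x θ, G.region c),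
    (r : ℝ≥0∞)

/-- The leader's worst-case utility over all `y ∈ Ωy`, used on the enclosing intervals. -/
def g (x : ℝ) (θ : Par m) : ℝ := sInf ((fun y => G.Ured x y θ) '' G.Ωy)

/-- Enclosing intervals for the zeros of `f₂(·, θ)`, for each deception parameter. -/
abbrev Enclosures := (θ : G.Θ) → G.Enclosure θ.1

/-- What the algorithm is run with: step sizes, tolerances, a starting state for every certainty
interval and a point of every enclosing interval at which `g` is evaluated. -/
structure Input (E : G.Enclosures) where
  γ : ℝ
  α : ℕ → ℝ
  σ : ℕ → ℝ
  init : (θ : G.Θ) → Fin ((E θ).q + 1) → State N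
  rep : (θ : G.Θ) → Fin (E θ).q → ℝ

variable {G}

namespace Input

variable {E : G.Enclosures} (A : G.Input E)

/-- The outer iterates on the `i`-th certainty interval for the parameter `θ`. -/
def run (μ κ : ℝ) (θ : G.Θ) (i : Fin ((E θ).q + 1)) (k : ℕ) : State N :=
  G.iter (contr μ κ A.γ) A.γ θ.1 ((E θ).left i) ((E θ).right i) A.α A.σ (A.init θ i) k

/-- Admissible inputs. -/
structure Admissible (μ κ : ℝ) : Prop where
  γ_pos : 0 < A.γ
  γ_lt : A.γ < 2 * μ / κ ^ 2
  α_nonneg : ∀ k, 0 ≤ A.α k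
  α_not_summable : ¬ Summable A.α
  α_sq_summable : Summable fun k => A.α k ^ 2
  σ_pos : ∀ k, 0 < A.σ k
  ασ_summable : Summable fun k => A.α k * A.σ k
  init_x : ∀ (θ : G.Θ) (i : Fin ((E θ).q + 1)), (E θ).left i < (E θ).right i →
    (A.init θ i).x ∈ Set.Icc ((E θ).left i) ((E θ).right i)
  init_z : ∀ (θ : G.Θ) (i : Fin ((E θ).q + 1)), (E θ).left i < (E θ).right i →
    (A.init θ i).z ∈ G.Ωz
  rep_mem : ∀ (θ : G.Θ) (j : Fin (E θ).q), A.rep θ j ∈ (E θ).I j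

/-- On every certainty interval the tolerances are eventually smaller than `δ(xᵏ)`. -/
def TolBelowRadius (μ κ : ℝ) : Prop :=
  ∀ (θ : G.Θ) (i : Fin ((E θ).q + 1)), (E θ).left i < (E θ).right i →
    ∃ k' : ℕ, ∀ k, k' < k → ENNReal.ofReal (A.σ k) < G.radius A.γ (A.run μ κ θ i k).x θ.1

/-- On every certainty interval `𝒫(xᵏ)` is a singleton for all but finitely many `k`. -/
def EventuallySingleton (μ κ : ℝ) : Prop :=
  ∀ (θ : G.Θ) (i : Fin ((E θ).q + 1)), (E θ).left i < (E θ).right i →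
    {k : ℕ | ¬ ∃ c, G.active A.γ (A.run μ κ θ i k).x θ.1 = {c}}.Finite

/-- The candidates `(x, recorded utility)` for the parameter `θ`, given the limits `lim` of the
outer iterates: the limits on the nondegenerate certainty intervals, with their utility, and the
chosen points of the enclosing intervals, with their worst-case utility. -/
def candidates (lim : (θ : G.Θ) → Fin ((E θ).q + 1) → ℝ) (θ : G.Θ) : Set (ℝ × ℝ) :=
  {c | ∃ i, (E θ).left i < (E θ).right i ∧
      c = (lim θ i, G.Ured (lim θ i) (G.phi₁ (lim θ i) θ.1) θ.1)} ∪
    {c | ∃ j, c = (A.rep θ j, G.g (A.rep θ j) θ.1)}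

/-- `(U, x, θ)` is returned: `x` is a candidate for `θ` whose recorded utility `U` is largest
among all candidates for all parameters. -/
def IsOutput (lim : (θ : G.Θ) → Fin ((E θ).q + 1) → ℝ) (U x : ℝ) (θ : G.Θ) : Prop :=
  (x, U) ∈ A.candidates lim θ ∧ ∀ θ' : G.Θ, ∀ c ∈ A.candidates lim θ', c.2 ≤ U

/-- The algorithm converges to `ε`-WDSE strategies: all inner loops stop, on each certainty interval
the outer iterates converge, and the comparison of the candidates returns, whichever way ties are
broken, a pair `(x, θ)` that is part of an `ε`-WDSE. -/
def ConvergesToEpsWDSE (μ κ ε : ℝ) : Prop :=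
  (∀ (θ : G.Θ) (i : Fin ((E θ).q + 1)), (E θ).left i < (E θ).right i → ∀ k,
    G.InnerStops (contr μ κ A.γ) A.γ (A.run μ κ θ i k).x (G.phi₁ (A.run μ κ θ i k).x θ.1) θ.1
      (A.run μ κ θ i k).z (A.σ k)) ∧
  ∃ lim : (θ : G.Θ) → Fin ((E θ).q + 1) → ℝ,
    (∀ (θ : G.Θ) (i : Fin ((E θ).q + 1)), (E θ).left i < (E θ).right i →
      Filter.Tendsto (fun k => (A.run μ κ θ i k).x) Filter.atTop (nhds (lim θ i))) ∧
    (∃ U x θ, A.IsOutput lim U x θ) ∧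
    ∀ U x θ, A.IsOutput lim U x θ → ∃ y z, G.IsEpsWDSE ε x y z θ.1

end Input

end Game

end Deception

end

/-!
For a fixed deception parameter `θ`, the projected pseudogradient step `h(x, y, ·)` is a contraction
of the box `Ωz` with constant `η`, and its fixed point is the unique equilibrium `brZ x y θ` of the
bottom level (`mem_BRZ_iff`, `norm_h_sub_le`). Hence the equilibrium, and with it the reduced utility
`Ured`, is Lipschitz in `(x, y)` (`exists_lipschitz_Ured`).

*Convergence on a certainty interval.* There `f₂(·, θ)` has no zeros, so the middle level responds
with a constant `y`, and `Ured · y θ` is concave. When `𝒫(xᵏ)` is a singleton and `σᵏ < δ(xᵏ)`, the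
pseudogradient step at the equilibrium lies in the interior of one of the boxes on which the
projection is affine. So `h` is differentiable there, the equilibrium has a derivative `s*` solving
the linearized fixed-point equation (`hasDerivWithinAt_brZ`), and the hypergradient formed with `s*`
is the derivative of the reduced utility (`hasDerivWithinAt_Ured`). The inner loop approximates `s*`
up to a multiple of `σᵏ` (`norm_innerLoop_snd_sub_le`). The sensitivity recursion contracts, and the
Jacobians used in it are off by a multiple of `‖z̃ʲ⁺¹ - z*‖`, hence of the displacement
`‖z̃ʲ⁺² - z̃ʲ⁺¹‖` that enters the stopping rule, as long as the pseudogradient step stays within `σᵏ`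
of its value at equilibrium. If it does not, then `1 ≤ ηʲ⁺¹ / (1 - η)`; weighting the bounded Jacobian
errors with the square of this quantity makes their total contribution a multiple of `ηˡ`, which the
stopping rule bounds by `σᵏ`.

The outer iteration is therefore projected ascent for a concave function of one variable with errors
proportional to `σᵏ`. As `∑ αᵏσᵏ` and `∑ (αᵏ)²` are finite, the distances to every maximizer converge,
and as `∑ αᵏ` is infinite some subsequence converges to a maximizer
(`exists_tendsto_isMaxOn_of_projected_ascent`). This argument gives convergence of the whole sequence
from concavity alone.

*Degenerate boxes.* If `zmin i = zmax i` for some `i`, strong monotonicity says nothing about the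
derivative of `F` in the `i`-th direction. All contraction estimates for Jacobians are therefore
restricted to the subspace `tangent` of directions along the box, which contains every sensitivity
iterate after the first step.

*Comparison.* Let `K` be a Lipschitz constant of `Ured` in `x`, let `d` be the least distance of two
points of `{xmin, xmax} ∪ {zeros}`, and let `M` be a bound for the absolute values of the pessimistic
utility. The constant is `L = K + 4M/d + 1`. If `ε ≥ 2M`, every strategy is `ε`-optimal. Otherwise the
enclosing intervals are shorter than `d/2`, so a nondegenerate certainty interval separates any two
consecutive points, and each `x` that is not a zero is within `ε/L` of a point of a certainty interval
with the same middle-level response (`exists_near_certainty`). At a zero the pessimistic utility is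
`g`, which is compared with the recorded value of `g` on the same enclosing interval.
-/

namespace Deception

open Filter Set Topology

/-! ### Inexact projected ascent on an interval -/

theorem abs_clamp_sub_clamp_le (a b s t : ℝ) :
    |max a (min b s) - max a (min b t)| ≤ |s - t| := by
  rw [max_comm a, max_comm a, min_comm b, min_comm b]
  refine (abs_max_sub_max_le_abs _ _ _).trans ?_
  simpa using abs_min_sub_min_le_max s b t b

theorem clamp_mem {a b : ℝ} (h : a ≤ b) (t : ℝ) : max a (min b t) ∈ Icc a b :=
  ⟨le_max_left _ _, max_le h (min_le_left _ _)⟩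

theorem clamp_of_mem {a b t : ℝ} (h : t ∈ Icc a b) : max a (min b t) = t := by
  rw [min_eq_right h.2, max_eq_right h.1]

/-- A sequence of nonnegative reals that decreases up to summable errors converges, and the
decrements are summable. -/
theorem exists_tendsto_of_le_add_sub {D w c : ℕ → ℝ} (hD : ∀ k, 0 ≤ D k) (hw : ∀ k, 0 ≤ w k)
    (hc : ∀ k, 0 ≤ c k) (hws : Summable w) (h : ∀ k, D (k + 1) ≤ D k + w k - c k) :
    (∃ l, Tendsto D atTop (𝓝 l)) ∧ Summable c := by
  have key : ∀ n, D n + ∑ k ∈ Finset.range n, c k ≤ D 0 + ∑ k ∈ Finset.range n, w k := by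
    intro n
    induction n with
    | zero => simp
    | succ n ih =>
      rw [Finset.sum_range_succ, Finset.sum_range_succ]
      linarith [h n]
  have hle : ∀ n, ∑ k ∈ Finset.range n, w k ≤ ∑' k, w k := fun n =>
    hws.sum_le_tsum _ fun k _ => hw k
  refine ⟨?_, summable_of_sum_range_le (c := D 0 + ∑' k, w k) hc fun n => by
    linarith [key n, hle n, hD n]⟩
  have hanti : Antitone fun n => D n - ∑ k ∈ Finset.range n, w k := by
    refine antitone_nat_of_succ_le fun n => ?_
    rw [Finset.sum_range_succ]
    linarith [h n, hc n]
  have hbdd : BddBelow (range fun n => D n - ∑ k ∈ Finset.range n, w k) := by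
    refine ⟨-∑' k, w k, ?_⟩
    rintro _ ⟨n, rfl⟩
    have h1 := hle n
    have h2 := hD n
    simp only
    linarith
  refine ⟨_, ((tendsto_atTop_ciInf hanti hbdd).add hws.hasSum.tendsto_sum_nat).congr fun n => ?_⟩
  ring

/-- Projected ascent on `[b, a]` along directions `d k` that are supergradients up to errors `e k`
converges to a maximizer: the distance to every maximizer decreases up to summable errors, and the
values come arbitrarily close to the maximum because the step sizes are not summable. -/
theorem exists_tendsto_isMaxOn_of_projected_ascent {b a M : ℝ} {φ : ℝ → ℝ}
    {x d α e : ℕ → ℝ} (hφ : ContinuousOn φ (Icc b a)) (hx : ∀ k, x k ∈ Icc b a)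
    (hstep : ∀ k, x (k + 1) = max b (min a (x k + α k * d k)))
    (hgrad : ∀ k, ∀ u ∈ Icc b a, φ u - φ (x k) ≤ d k * (u - x k) + e k)
    (hM : ∀ k, |d k| ≤ M) (he : ∀ k, 0 ≤ e k) (hα : ∀ k, 0 ≤ α k) (hα1 : ¬ Summable α)
    (hα2 : Summable fun k => α k ^ 2) (hαe : Summable fun k => α k * e k) :
    ∃ v ∈ Icc b a, Tendsto x atTop (𝓝 v) ∧ IsMaxOn φ (Icc b a) v := by
  obtain ⟨u₀, hu₀, hmax₀⟩ := isCompact_Icc.exists_isMaxOn ⟨x 0, hx 0⟩ hφ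
  have fejer : ∀ v ∈ Icc b a, IsMaxOn φ (Icc b a) v →
      (∃ l, Tendsto (fun k => (x k - v) ^ 2) atTop (𝓝 l)) ∧
        Summable fun k => 2 * (α k * (φ v - φ (x k))) := by
    intro v hv hmax
    refine exists_tendsto_of_le_add_sub (w := fun k => 2 * (α k * e k) + M ^ 2 * α k ^ 2)
      (fun k => sq_nonneg _) (fun k => ?_) (fun k => ?_) ((hαe.mul_left 2).add (hα2.mul_left _))
      fun k => ?_
    · have := mul_nonneg (hα k) (he k)
      positivity
    · have := hmax (hx k)
      simp only [mem_ofPred_eq] at this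
      have := mul_nonneg (hα k) (sub_nonneg.2 this)
      positivity
    · have h1 : |x (k + 1) - v| ≤ |x k + α k * d k - v| := by
        have := abs_clamp_sub_clamp_le b a (x k + α k * d k) v
        rwa [← hstep, clamp_of_mem hv] at this
      have h2 := sq_le_sq.2 h1
      have h3 := mul_le_mul_of_nonneg_left (hgrad k v hv) (hα k)
      have h4 : d k ^ 2 ≤ M ^ 2 := by
        rw [← sq_abs]
        exact pow_le_pow_left₀ (abs_nonneg _) (hM k) 2
      have h5 := mul_le_mul_of_nonneg_left h4 (sq_nonneg (α k))
      nlinarith [h2, h3, h5]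
  -- the values cannot stay away from the maximum, since `α` would then be summable
  have hfreq : ∀ n : ℕ, ∃ᶠ k in atTop, φ u₀ - φ (x k) < 1 / ((n : ℝ) + 1) := by
    intro n hcon
    apply hα1
    obtain ⟨-, hs⟩ := fejer u₀ hu₀ hmax₀
    have hn : (0 : ℝ) < (n : ℝ) + 1 := by positivity
    refine Summable.of_norm_bounded_eventually_nat (hs.mul_left (((n : ℝ) + 1) / 2)) ?_
    filter_upwards [hcon] with k hk
    rw [not_lt, div_le_iff₀ hn] at hk
    rw [Real.norm_of_nonneg (hα k)]
    nlinarith [hα k]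
  obtain ⟨ψ, hψ, hlt⟩ := extraction_forall_of_frequently hfreq
  obtain ⟨v, hv, χ, hχ, hlim⟩ := isCompact_Icc.tendsto_subseq fun n => hx (ψ n)
  have hφlim : Tendsto (fun n => φ (x (ψ (χ n)))) atTop (𝓝 (φ v)) :=
    (hφ v hv).tendsto.comp (tendsto_nhdsWithin_iff.2 ⟨hlim, Eventually.of_forall fun n => hx _⟩)
  have hsmall : Tendsto (fun n : ℕ => 1 / ((χ n : ℝ) + 1)) atTop (𝓝 0) :=
    tendsto_one_div_add_atTop_nhds_zero_nat.comp hχ.tendsto_atTop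
  have hle : φ u₀ - φ v ≤ 0 :=
    le_of_tendsto_of_tendsto' (tendsto_const_nhds.sub hφlim) hsmall fun n => (hlt (χ n)).le
  have hmaxv : IsMaxOn φ (Icc b a) v := fun u hu => by
    have := hmax₀ hu
    simp only [mem_ofPred_eq] at this ⊢
    linarith
  refine ⟨v, hv, ?_, hmaxv⟩
  obtain ⟨⟨l, hl⟩, -⟩ := fejer v hv hmaxv
  have hl0 : l = 0 := by
    have h1 : Tendsto (fun n => (x (ψ (χ n)) - v) ^ 2) atTop (𝓝 l) :=
      hl.comp (hψ.comp hχ).tendsto_atTop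
    have h2 : Tendsto (fun n => (x (ψ (χ n)) - v) ^ 2) atTop (𝓝 0) := by
      have h3 : Tendsto (fun n => (x (ψ (χ n)) - v) ^ 2) atTop (𝓝 ((v - v) ^ 2)) :=
        (hlim.sub_const v).pow 2
      simpa using h3
    exact tendsto_nhds_unique h1 h2
  rw [hl0] at hl
  rw [tendsto_iff_norm_sub_tendsto_zero]
  have := (Real.continuous_sqrt.tendsto _).comp hl
  rw [Real.sqrt_zero] at this
  exact this.congr fun k => by simp [Real.sqrt_sq_eq_abs]

/-! ### One-variable and compactness preliminaries -/

theorem concaveOn_sub_le_of_hasDerivWithinAt {S : Set ℝ} {φ : ℝ → ℝ} {z t d : ℝ}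
    (hφ : ConcaveOn ℝ S φ) (hz : z ∈ S) (ht : t ∈ S) (hd : HasDerivWithinAt φ d S z) :
    φ t - φ z ≤ d * (t - z) := by
  rcases lt_trichotomy z t with h | h | h
  · have := ConcaveOn.slope_le_of_hasDerivWithinAt hφ hz ht h hd
    rwa [slope_def_field, div_le_iff₀ (sub_pos.2 h)] at this
  · simp [h]
  · have := ConcaveOn.le_slope_of_hasDerivWithinAt hφ ht hz h hd
    rw [slope_def_field, le_div_iff₀ (sub_pos.2 h)] at this
    linarith

/-- For a concave function on `[a, b]`, maximizers are the fixed points of the projected gradient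
step. -/
theorem concaveOn_isMax_iff_clamp {a b γ z d : ℝ} (hγ : 0 < γ) {φ : ℝ → ℝ}
    (hφ : ConcaveOn ℝ (Icc a b) φ) (hz : z ∈ Icc a b) (hd : HasDerivAt φ d z) :
    (∀ t ∈ Icc a b, φ t ≤ φ z) ↔ max a (min b (z + γ * d)) = z := by
  have grad : ∀ t ∈ Icc a b, φ t - φ z ≤ d * (t - z) := fun t ht =>
    concaveOn_sub_le_of_hasDerivWithinAt hφ hz ht hd.hasDerivWithinAt
  constructor
  · intro hmax
    have hmaxOn : IsLocalMaxOn φ (Icc a b) z :=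
      IsMaxOn.localize fun t ht => hmax t ht
    have hdir : ∀ t ∈ Icc a b, d * (t - z) ≤ 0 := by
      intro t ht
      have := hmaxOn.hasFDerivWithinAt_nonpos hd.hasFDerivAt.hasFDerivWithinAt
        (sub_mem_posTangentConeAt_of_segment_subset ((convex_Icc a b).segment_subset hz ht))
      simpa [mul_comm] using this
    rcases lt_trichotomy d 0 with h | h | h
    · have hza : z ≤ a := by
        have := hdir a ⟨le_rfl, hz.1.trans hz.2⟩
        nlinarith
      have hd' : γ * d < 0 := mul_neg_of_pos_of_neg hγ h
      rw [max_eq_left ((min_le_right _ _).trans (by linarith))]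
      exact le_antisymm hz.1 hza
    · rw [h, mul_zero, add_zero, clamp_of_mem hz]
    · have hzb : b ≤ z := by
        have := hdir b ⟨hz.1.trans hz.2, le_rfl⟩
        nlinarith
      have hd' : 0 < γ * d := mul_pos hγ h
      rw [min_eq_left (by linarith), max_eq_right (hz.1.trans hz.2)]
      exact le_antisymm hzb hz.2
  · intro hfix t ht
    have h0 : d * (t - z) ≤ 0 := by
      rcases lt_trichotomy d 0 with h | h | h
      · have hd' : γ * d < 0 := mul_neg_of_pos_of_neg hγ h
        have hza : z ≤ a := by
          by_contra! hlt
          have : max a (min b (z + γ * d)) < z :=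
            max_lt hlt ((min_le_right _ _).trans_lt (by linarith))
          exact this.ne hfix
        nlinarith [ht.1]
      · simp [h]
      · have hd' : 0 < γ * d := mul_pos hγ h
        have hzb : b ≤ z := by
          by_contra! hlt
          have : z < max a (min b (z + γ * d)) :=
            lt_max_of_lt_right (lt_min hlt (by linarith))
          exact this.ne' hfix
        nlinarith [ht.2]
    linarith [grad t ht]

/-- A function that is `C¹` near every point of a compact convex set has bounded derivative on the
set and is Lipschitz there. -/
theorem exists_bound_of_contDiffAt {E F : Type*} [NormedAddCommGroup E] [NormedSpace ℝ E]
    [NormedAddCommGroup F] [NormedSpace ℝ F] {K : Set E} (hK : IsCompact K) (hc : Convex ℝ K)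
    {f : E → F} (hf : ∀ p ∈ K, ContDiffAt ℝ 1 f p) :
    ∃ C : ℝ, 0 ≤ C ∧ (∀ p ∈ K, ‖fderiv ℝ f p‖ ≤ C) ∧
      ∀ p ∈ K, ∀ q ∈ K, ‖f p - f q‖ ≤ C * ‖p - q‖ := by
  have hcont : ContinuousOn (fderiv ℝ f) K := fun p hp =>
    ((hf p hp).continuousAt_fderiv one_ne_zero).continuousWithinAt
  obtain ⟨C, hC⟩ := hK.exists_bound_of_continuousOn hcont
  refine ⟨max C 0, le_max_right _ _, fun p hp => (hC p hp).trans (le_max_left _ _),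
    fun p hp q hq => ?_⟩
  exact hc.norm_image_sub_le_of_norm_fderiv_le
    (fun p hp => (hf p hp).differentiableAt one_ne_zero)
    (fun p hp => (hC p hp).trans (le_max_left _ _)) hq hp

/-- The derivative of `f = P ∘ g` with `P` nonexpansive is dominated by that of `g`, in every
direction. -/
theorem norm_fderiv_apply_le_of_nonexpansive {E F : Type*} [NormedAddCommGroup E]
    [NormedSpace ℝ E] [NormedAddCommGroup F] [NormedSpace ℝ F] {f g : E → F} {z : E}
    (hfg : ∀ w, ‖f w - f z‖ ≤ ‖g w - g z‖) {g' : E →L[ℝ] F} (hg : HasFDerivAt g g' z) (v : E) :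
    ‖fderiv ℝ f z v‖ ≤ ‖g' v‖ := by
  by_cases hf : DifferentiableAt ℝ f z
  · have hline : HasDerivAt (fun t : ℝ => z + t • v) v 0 := by
      simpa using ((hasDerivAt_id (0 : ℝ)).smul_const v).const_add z
    have h1 : HasDerivAt (fun t : ℝ => f (z + t • v)) (fderiv ℝ f z v) 0 := by
      have := hf.hasFDerivAt
      rw [← show z + (0 : ℝ) • v = z by simp] at this
      have h3 := this.comp_hasDerivAt (0 : ℝ) hline
      rwa [show z + (0 : ℝ) • v = z by simp] at h3
    have h2 : HasDerivAt (fun t : ℝ => g (z + t • v)) (g' v) 0 := by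
      rw [← show z + (0 : ℝ) • v = z by simp] at hg
      exact hg.comp_hasDerivAt (0 : ℝ) hline
    rw [hasDerivAt_iff_tendsto_slope] at h1 h2
    refine le_of_tendsto_of_tendsto' h1.norm h2.norm fun t => ?_
    simp only [slope_def_module, zero_smul, add_zero, norm_smul]
    exact mul_le_mul_of_nonneg_left (hfg _) (norm_nonneg _)
  · rw [fderiv_zero_of_not_differentiableAt hf]
    simp

/-- The points of a finite set of reals keep a positive distance. -/
theorem exists_gap {S : Set ℝ} (hS : S.Finite) :
    ∃ d : ℝ, 0 < d ∧ ∀ s ∈ S, ∀ t ∈ S, s < t → d ≤ t - s := by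
  have hfin : ((fun p : ℝ × ℝ => p.2 - p.1) '' {p ∈ S ×ˢ S | p.1 < p.2}).Finite :=
    ((hS.prod hS).subset fun p hp => hp.1).image _
  rcases ((fun p : ℝ × ℝ => p.2 - p.1) '' {p ∈ S ×ˢ S | p.1 < p.2}).eq_empty_or_nonempty
    with he | hne
  · refine ⟨1, one_pos, fun s hs t ht hst => ?_⟩
    have : t - s ∈ ((fun p : ℝ × ℝ => p.2 - p.1) '' {p ∈ S ×ˢ S | p.1 < p.2}) :=
      ⟨(s, t), ⟨⟨hs, ht⟩, hst⟩, rfl⟩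
    rw [he] at this
    exact this.elim
  · obtain ⟨d, ⟨p, hp, rfl⟩, hd⟩ := Set.exists_min_image _ id hfin hne
    exact ⟨p.2 - p.1, sub_pos.2 hp.2, fun s hs t ht hst => hd _ ⟨(s, t), ⟨⟨hs, ht⟩, hst⟩, rfl⟩⟩

/-! ### Linear recursions with a contraction factor -/

theorem le_pow_mul_add_sum {η : ℝ} (hη : 0 ≤ η) {e r : ℕ → ℝ}
    (h : ∀ j, e (j + 1) ≤ η * e j + r j) (l : ℕ) :
    e l ≤ η ^ l * e 0 + ∑ j ∈ Finset.range l, η ^ (l - 1 - j) * r j := by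
  induction l with
  | zero => simp
  | succ l ih =>
    rw [Finset.sum_range_succ]
    have h1 : ∑ j ∈ Finset.range l, η ^ (l + 1 - 1 - j) * r j
        = η * ∑ j ∈ Finset.range l, η ^ (l - 1 - j) * r j := by
      rw [Finset.mul_sum]
      refine Finset.sum_congr rfl fun j hj => ?_
      have hj' := Finset.mem_range.1 hj
      rw [show l + 1 - 1 - j = (l - 1 - j) + 1 by omega, pow_succ]
      ring
    rw [h1]
    have h2 := mul_le_mul_of_nonneg_left ih hη
    have h3 := h l
    simp only [add_tsub_cancel_right, tsub_self, pow_zero, one_mul]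
    rw [pow_succ]
    linarith

theorem sum_pow_le {η : ℝ} (h0 : 0 ≤ η) (h1 : η < 1) (l : ℕ) :
    ∑ j ∈ Finset.range l, η ^ j ≤ 1 / (1 - η) := by
  rw [le_div_iff₀ (sub_pos.2 h1), geom_sum_mul_neg]
  linarith [pow_nonneg h0 l]

/-- The bound for the second phase of the inner loop: errors caused by displacements `d` are
controlled by the stopping criterion, and errors of size `(η ^ (j + 1)) ^ 2` decay fast enough to be
controlled by `η ^ l`. -/
theorem le_mul_of_stop {η σ a b : ℝ} (h0 : 0 ≤ η) (h1 : η < 1) (ha : 0 ≤ a) (hb : 0 ≤ b)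
    {e d : ℕ → ℝ} (he : 0 ≤ e 0) (hd : ∀ j, 0 ≤ d j)
    (h : ∀ j, e (j + 1) ≤ η * e j + (a * d (j + 1) + b * (η ^ (j + 1)) ^ 2)) {l : ℕ}
    (hl : η ^ l ≤ σ) (hl' : ∑ j ∈ Finset.range (l + 1), η ^ (l - j) * d j ≤ σ) :
    e l ≤ (e 0 + a + b / (1 - η)) * σ := by
  have key := le_pow_mul_add_sum h0 h l
  have e1 : ∑ j ∈ Finset.range l, η ^ (l - 1 - j) * (a * d (j + 1) + b * (η ^ (j + 1)) ^ 2)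
      = a * ∑ j ∈ Finset.range l, η ^ (l - (j + 1)) * d (j + 1)
        + b * (η ^ (l + 1) * ∑ j ∈ Finset.range l, η ^ j) := by
    rw [Finset.mul_sum, Finset.mul_sum, Finset.mul_sum, ← Finset.sum_add_distrib]
    refine Finset.sum_congr rfl fun j hj => ?_
    have hj' := Finset.mem_range.1 hj
    obtain ⟨i, rfl⟩ : ∃ i, l = j + 1 + i := ⟨l - (j + 1), by omega⟩
    rw [show j + 1 + i - 1 - j = i by omega, show j + 1 + i - (j + 1) = i by omega]
    ring
  have e2 : ∑ j ∈ Finset.range l, η ^ (l - (j + 1)) * d (j + 1) ≤ σ := by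
    rw [Finset.sum_range_succ'] at hl'
    have := mul_nonneg (pow_nonneg h0 (l - 0)) (hd 0)
    linarith
  have e3 : η ^ (l + 1) * ∑ j ∈ Finset.range l, η ^ j ≤ σ * (1 / (1 - η)) := by
    refine mul_le_mul ((pow_le_pow_of_le_one h0 h1.le (Nat.le_succ l)).trans hl)
      (sum_pow_le h0 h1 l) (Finset.sum_nonneg fun j _ => pow_nonneg h0 j) ?_
    exact (pow_nonneg h0 l).trans hl
  rw [e1] at key
  have e4 := mul_le_mul_of_nonneg_left e2 ha
  have e5 := mul_le_mul_of_nonneg_left e3 hb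
  have e6 := mul_le_mul_of_nonneg_right hl he
  calc e l ≤ σ * e 0 + (a * σ + b * (σ * (1 / (1 - η)))) := by linarith
    _ = _ := by ring

namespace Game

variable {m N : ℕ} {G : Game m N} {μ κ γ x y σ : ℝ} {θ : Par m} {z s : Prof N}

/-! ### The strategy sets and the projection -/

theorem isCompact_Ωz (G : Game m N) : IsCompact G.Ωz := by
  have h : IsCompact (Set.pi univ fun i => Icc (G.zmin i) (G.zmax i)) :=
    isCompact_univ_pi fun i => isCompact_Icc
  have := (EuclideanSpace.equiv (Fin N) ℝ).toHomeomorph.isCompact_preimage.2 h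
  convert this using 1
  ext z
  simp [Ωz, Pi.le_def, forall_and]

theorem convex_Ωz (G : Game m N) : Convex ℝ G.Ωz := by
  intro z hz w hw a b ha hb hab i
  simpa using (convex_Icc (G.zmin i) (G.zmax i)) (hz i) (hw i) ha hb hab

theorem projZ_mem (G : Game m N) (w : Prof N) : G.projZ w ∈ G.Ωz := fun i => by
  simpa [projZ] using clamp_mem (G.hz i) (w i)

/-- The joint strategy set. -/
def joint (G : Game m N) : Set (ℝ × ℝ × Prof N) := G.Ωx ×ˢ G.Ωy ×ˢ G.Ωz

theorem mk_mem_joint {z : Prof N} (hx : x ∈ G.Ωx) (hy : y ∈ G.Ωy) (hz : z ∈ G.Ωz) :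
    (x, y, z) ∈ G.joint := ⟨hx, hy, hz⟩

theorem isCompact_joint (G : Game m N) : IsCompact G.joint :=
  isCompact_Icc.prod (isCompact_Icc.prod G.isCompact_Ωz)

theorem convex_joint (G : Game m N) : Convex ℝ G.joint :=
  (convex_Icc _ _).prod ((convex_Icc _ _).prod G.convex_Ωz)

theorem norm_le_of_abs_le {v w : Prof N} (h : ∀ i, |v i| ≤ |w i|) : ‖v‖ ≤ ‖w‖ := by
  rw [EuclideanSpace.norm_eq, EuclideanSpace.norm_eq]
  refine Real.sqrt_le_sqrt (Finset.sum_le_sum fun i _ => ?_)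
  simp only [Real.norm_eq_abs]
  exact pow_le_pow_left₀ (abs_nonneg _) (h i) 2

theorem norm_projZ_sub_le (G : Game m N) (v w : Prof N) :
    ‖G.projZ v - G.projZ w‖ ≤ ‖v - w‖ :=
  norm_le_of_abs_le fun i => by
    simpa [projZ] using abs_clamp_sub_clamp_le (G.zmin i) (G.zmax i) (v i) (w i)

/-! ### The contraction and its fixed point -/

theorem contr_nonneg (μ κ γ : ℝ) : 0 ≤ contr μ κ γ := Real.sqrt_nonneg _

theorem contr_lt_one (hm : G.StronglyMonotone μ κ) (h0 : 0 < γ) (h1 : γ < 2 * μ / κ ^ 2) :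
    contr μ κ γ < 1 := by
  have hκ : 0 < κ ^ 2 := pow_pos hm.κ_pos 2
  rw [lt_div_iff₀ hκ] at h1
  rw [contr, Real.sqrt_lt' one_pos]
  nlinarith [mul_pos h0 (sub_pos.2 h1)]

theorem norm_omega_sub_le (hm : G.StronglyMonotone μ κ) (h0 : 0 < γ) (hθ : θ ∈ G.Θ)
    (hx : x ∈ G.Ωx) (hy : y ∈ G.Ωy) {z z' : Prof N} (hz : z ∈ G.Ωz) (hz' : z' ∈ G.Ωz) :
    ‖G.omega γ x y θ z - G.omega γ x y θ z'‖ ≤ contr μ κ γ * ‖z - z'‖ := by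
  have h1 := hm.monotone θ hθ x hx y hy z hz z' hz'
  have h2 := hm.lipschitz θ hθ x hx y hy z hz z' hz'
  have heq : G.omega γ x y θ z - G.omega γ x y θ z'
      = (z - z') - γ • (G.F x y z θ - G.F x y z' θ) := by
    simp only [omega, smul_sub]
    abel
  have hsq : ‖G.omega γ x y θ z - G.omega γ x y θ z'‖ ^ 2
      ≤ (1 - γ * (2 * μ - γ * κ ^ 2)) * ‖z - z'‖ ^ 2 := by
    rw [heq, norm_sub_sq_real, inner_smul_right, norm_smul, Real.norm_of_nonneg h0.le,
      real_inner_comm]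
    have h3 := pow_le_pow_left₀ (norm_nonneg _) h2 2
    nlinarith [mul_le_mul_of_nonneg_left h1 h0.le, mul_le_mul_of_nonneg_left h3 (sq_nonneg γ)]
  -- a negative radicand forces `z = z'`, so that the junk value `0` of the root is harmless
  rcases le_or_gt 0 (1 - γ * (2 * μ - γ * κ ^ 2)) with hr | hr
  · refine abs_le_of_sq_le_sq' ?_ (mul_nonneg (contr_nonneg _ _ _) (norm_nonneg _)) |>.2
    rwa [mul_pow, contr, Real.sq_sqrt hr]
  · have h4 : ‖z - z'‖ ^ 2 ≤ 0 := by
      by_contra! hpos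
      nlinarith [sq_nonneg ‖G.omega γ x y θ z - G.omega γ x y θ z'‖]
    have h5 : z = z' := by
      rw [← sub_eq_zero, ← norm_eq_zero]
      exact pow_eq_zero_iff two_ne_zero |>.1 (le_antisymm h4 (sq_nonneg _))
    simp [h5]

theorem h_mem (z : Prof N) : G.h γ x y θ z ∈ G.Ωz := G.projZ_mem _

theorem norm_h_sub_le (hm : G.StronglyMonotone μ κ) (h0 : 0 < γ) (hθ : θ ∈ G.Θ)
    (hx : x ∈ G.Ωx) (hy : y ∈ G.Ωy) {z z' : Prof N} (hz : z ∈ G.Ωz) (hz' : z' ∈ G.Ωz) :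
    ‖G.h γ x y θ z - G.h γ x y θ z'‖ ≤ contr μ κ γ * ‖z - z'‖ :=
  (G.norm_projZ_sub_le _ _).trans (norm_omega_sub_le hm h0 hθ hx hy hz hz')

theorem setCoord_self (z : Prof N) (i : Fin N) : setCoord z i (z i) = z := by
  ext j
  simp [setCoord]

theorem hasDerivAt_f₄ (hs : G.ConcaveSmooth) (hθ : θ ∈ G.Θ) (hx : x ∈ G.Ωx) (hy : y ∈ G.Ωy)
    {z : Prof N} (hz : z ∈ G.Ωz) (i : Fin N) :
    HasDerivAt (fun t => G.f₄ i x y (setCoord z i t) θ) (-G.F x y z θ i) (z i) := by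
  have h1 := (hs.UZ_smooth θ hθ x hx y hy z hz i).differentiableAt one_ne_zero
  have h2 : DifferentiableAt ℝ (fun t : ℝ => (x, y, setCoord z i t)) (z i) := by
    have h3 : DifferentiableAt ℝ (fun t : ℝ => setCoord z i t) (z i) := by
      rw [differentiableAt_euclidean]
      intro j
      by_cases hj : j = i
      · subst hj; simp [setCoord]
      · simp [setCoord, hj]
    fun_prop
  have h4 : DifferentiableAt ℝ (fun t => G.f₄ i x y (setCoord z i t) θ) (z i) := by
    rw [← setCoord_self z i] at h1
    simp only [setCoord_self] at h1
    have h1' : DifferentiableAt ℝ (fun p : ℝ × ℝ × Prof N => G.f₄ i p.1 p.2.1 p.2.2 θ)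
        ((fun t : ℝ => (x, y, setCoord z i t)) (z i)) := by
      simpa only [setCoord_self] using h1
    exact h1'.comp (z i) h2
  simpa [F] using h4.hasDerivAt

/-- Nash equilibria are the fixed points of the projected pseudogradient step. -/
theorem mem_BRZ_iff (hs : G.ConcaveSmooth) (h0 : 0 < γ) (hθ : θ ∈ G.Θ) (hx : x ∈ G.Ωx)
    (hy : y ∈ G.Ωy) {z : Prof N} : z ∈ G.BRZ x y θ ↔ z ∈ G.Ωz ∧ G.h γ x y θ z = z := by
  refine and_congr_right fun hz => ?_
  have key : ∀ i, (∀ t ∈ Icc (G.zmin i) (G.zmax i),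
      G.f₄ i x y (setCoord z i t) θ ≤ G.f₄ i x y z θ) ↔ G.h γ x y θ z i = z i := by
    intro i
    have := concaveOn_isMax_iff_clamp h0 (hs.UZ_concave θ hθ x hx y hy z hz i) (hz i)
      (hasDerivAt_f₄ hs hθ hx hy hz i)
    rw [setCoord_self] at this
    rw [this]
    simp [h, projZ, omega, sub_eq_add_neg]
  rw [forall_congr' key]
  exact ⟨fun h => by ext i; exact h i, fun h i => by rw [h]⟩

theorem exists_mem_BRZ (hs : G.ConcaveSmooth) (hm : G.StronglyMonotone μ κ) (hθ : θ ∈ G.Θ)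
    (hx : x ∈ G.Ωx) (hy : y ∈ G.Ωy) : ∃ z, z ∈ G.BRZ x y θ := by
  obtain ⟨γ, h0, h1⟩ : ∃ γ, 0 < γ ∧ γ < 2 * μ / κ ^ 2 :=
    exists_between (div_pos (mul_pos two_pos hm.μ_pos) (pow_pos hm.κ_pos 2))
  have hmaps : MapsTo (G.h γ x y θ) G.Ωz G.Ωz := fun z _ => h_mem z
  have hcon : ContractingWith (contr μ κ γ).toNNReal (hmaps.restrict _ _ _) := by
    refine ⟨by simpa using contr_lt_one hm h0 h1, LipschitzWith.of_dist_le_mul ?_⟩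
    rintro ⟨z, hz⟩ ⟨z', hz'⟩
    rw [Real.coe_toNNReal _ (contr_nonneg _ _ _), Subtype.dist_eq, Subtype.dist_eq, dist_eq_norm,
      dist_eq_norm]
    exact norm_h_sub_le hm h0 hθ hx hy hz hz'
  obtain ⟨z, hz, hfix, -⟩ := hcon.exists_fixedPoint' G.isCompact_Ωz.isComplete hmaps
    (G.projZ_mem 0) (edist_ne_top _ _)
  exact ⟨z, (mem_BRZ_iff hs h0 hθ hx hy).2 ⟨hz, hfix⟩⟩

theorem brZ_mem_BRZ (hs : G.ConcaveSmooth) (hm : G.StronglyMonotone μ κ) (hθ : θ ∈ G.Θ)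
    (hx : x ∈ G.Ωx) (hy : y ∈ G.Ωy) : G.brZ x y θ ∈ G.BRZ x y θ :=
  Classical.epsilon_spec (exists_mem_BRZ hs hm hθ hx hy)

theorem brZ_mem (hs : G.ConcaveSmooth) (hm : G.StronglyMonotone μ κ) (hθ : θ ∈ G.Θ)
    (hx : x ∈ G.Ωx) (hy : y ∈ G.Ωy) : G.brZ x y θ ∈ G.Ωz :=
  (brZ_mem_BRZ hs hm hθ hx hy).1

theorem h_brZ (hs : G.ConcaveSmooth) (hm : G.StronglyMonotone μ κ) (h0 : 0 < γ) (hθ : θ ∈ G.Θ)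
    (hx : x ∈ G.Ωx) (hy : y ∈ G.Ωy) : G.h γ x y θ (G.brZ x y θ) = G.brZ x y θ :=
  ((mem_BRZ_iff hs h0 hθ hx hy).1 (brZ_mem_BRZ hs hm hθ hx hy)).2

theorem eq_brZ (hs : G.ConcaveSmooth) (hm : G.StronglyMonotone μ κ) (hθ : θ ∈ G.Θ)
    (hx : x ∈ G.Ωx) (hy : y ∈ G.Ωy) {z : Prof N} (hz : z ∈ G.BRZ x y θ) : z = G.brZ x y θ := by
  obtain ⟨γ, h0, h1⟩ : ∃ γ, 0 < γ ∧ γ < 2 * μ / κ ^ 2 :=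
    exists_between (div_pos (mul_pos two_pos hm.μ_pos) (pow_pos hm.κ_pos 2))
  have hfix := ((mem_BRZ_iff hs h0 hθ hx hy).1 hz).2
  have := norm_h_sub_le hm h0 hθ hx hy hz.1 (brZ_mem hs hm hθ hx hy)
  rw [hfix, h_brZ hs hm h0 hθ hx hy] at this
  rw [← sub_eq_zero, ← norm_eq_zero]
  have h2 := contr_lt_one hm h0 h1
  nlinarith [norm_nonneg (z - G.brZ x y θ)]

/-! ### Bounds on the strategy sets -/

theorem exists_bound_F (hm : G.StronglyMonotone μ κ) (hθ : θ ∈ G.Θ) :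
    ∃ C : ℝ, 0 ≤ C ∧
      (∀ p ∈ G.joint, ‖fderiv ℝ (fun p : ℝ × ℝ × Prof N => G.F p.1 p.2.1 p.2.2 θ) p‖ ≤ C) ∧
      ∀ p ∈ G.joint, ∀ q ∈ G.joint,
        ‖G.F p.1 p.2.1 p.2.2 θ - G.F q.1 q.2.1 q.2.2 θ‖ ≤ C * ‖p - q‖ :=
  exists_bound_of_contDiffAt G.isCompact_joint G.convex_joint
    fun _ hp => hm.smooth θ hθ _ hp.1 _ hp.2.1 _ hp.2.2

theorem exists_bound_UX (hs : G.ConcaveSmooth) :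
    ∃ C : ℝ, 0 ≤ C ∧
      (∀ p ∈ G.joint, ‖fderiv ℝ (fun p : ℝ × ℝ × Prof N => G.UX p.1 p.2.1 p.2.2) p‖ ≤ C) ∧
      ∀ p ∈ G.joint, ∀ q ∈ G.joint,
        ‖G.UX p.1 p.2.1 p.2.2 - G.UX q.1 q.2.1 q.2.2‖ ≤ C * ‖p - q‖ :=
  exists_bound_of_contDiffAt G.isCompact_joint G.convex_joint
    fun _ hp => hs.UX_smooth _ hp.1 _ hp.2.1 _ hp.2.2

/-- The equilibrium response is Lipschitz, since the fixed points of a uniform contraction depend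
on parameters in a Lipschitz way. -/
theorem exists_lipschitz_brZ (hs : G.ConcaveSmooth) (hm : G.StronglyMonotone μ κ) (hθ : θ ∈ G.Θ) :
    ∃ C : ℝ, 0 ≤ C ∧ ∀ x ∈ G.Ωx, ∀ y ∈ G.Ωy, ∀ x' ∈ G.Ωx, ∀ y' ∈ G.Ωy,
      ‖G.brZ x y θ - G.brZ x' y' θ‖ ≤ C * max |x - x'| |y - y'| := by
  obtain ⟨γ, h0, h1⟩ : ∃ γ, 0 < γ ∧ γ < 2 * μ / κ ^ 2 :=
    exists_between (div_pos (mul_pos two_pos hm.μ_pos) (pow_pos hm.κ_pos 2))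
  obtain ⟨C, hC, -, hlip⟩ := exists_bound_F hm hθ
  have hη := contr_lt_one hm h0 h1
  refine ⟨γ * C / (1 - contr μ κ γ), by have := sub_pos.2 hη; positivity,
    fun x hx y hy x' hx' y' hy' => ?_⟩
  set z := G.brZ x y θ with hz
  set z' := G.brZ x' y' θ with hz'
  have hzm : z ∈ G.Ωz := brZ_mem hs hm hθ hx hy
  have hzm' : z' ∈ G.Ωz := brZ_mem hs hm hθ hx' hy'
  have hfix : G.h γ x y θ z = z := h_brZ hs hm h0 hθ hx hy
  have hfix' : G.h γ x' y' θ z' = z' := h_brZ hs hm h0 hθ hx' hy'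
  have e1 : ‖z - z'‖ ≤ ‖G.h γ x y θ z - G.h γ x y θ z'‖
      + ‖G.h γ x y θ z' - G.h γ x' y' θ z'‖ := by
    calc ‖z - z'‖ = ‖G.h γ x y θ z - G.h γ x' y' θ z'‖ := by rw [hfix, hfix']
      _ ≤ _ := norm_sub_le_norm_sub_add_norm_sub _ _ _
  have e2 := norm_h_sub_le hm h0 hθ hx hy hzm hzm'
  have e3 : ‖G.h γ x y θ z' - G.h γ x' y' θ z'‖ ≤ γ * (C * max |x - x'| |y - y'|) := by
    refine (G.norm_projZ_sub_le _ _).trans ?_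
    have : G.omega γ x y θ z' - G.omega γ x' y' θ z'
        = -(γ • (G.F x y z' θ - G.F x' y' z' θ)) := by
      simp only [omega, smul_sub]; abel
    rw [this, norm_neg, norm_smul, Real.norm_of_nonneg h0.le]
    refine mul_le_mul_of_nonneg_left ?_ h0.le
    have := hlip (x, y, z') ⟨hx, hy, hzm'⟩ (x', y', z') ⟨hx', hy', hzm'⟩
    simpa [Prod.norm_def] using this
  rw [div_mul_eq_mul_div, le_div_iff₀ (sub_pos.2 hη)]
  linarith

theorem exists_lipschitz_Ured (hs : G.ConcaveSmooth) (hm : G.StronglyMonotone μ κ)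
    (hθ : θ ∈ G.Θ) :
    ∃ C : ℝ, 0 ≤ C ∧ ∀ x ∈ G.Ωx, ∀ y ∈ G.Ωy, ∀ x' ∈ G.Ωx, ∀ y' ∈ G.Ωy,
      |G.Ured x y θ - G.Ured x' y' θ| ≤ C * max |x - x'| |y - y'| := by
  obtain ⟨C, hC, hlip⟩ := exists_lipschitz_brZ hs hm hθ
  obtain ⟨D, hD, -, hlipU⟩ := exists_bound_UX hs
  refine ⟨D * (1 + C), by positivity, fun x hx y hy x' hx' y' hy' => ?_⟩
  have h1 := hlipU (x, y, G.brZ x y θ) ⟨hx, hy, brZ_mem hs hm hθ hx hy⟩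
    (x', y', G.brZ x' y' θ) ⟨hx', hy', brZ_mem hs hm hθ hx' hy'⟩
  rw [Real.norm_eq_abs] at h1
  refine h1.trans ?_
  rw [mul_assoc]
  refine mul_le_mul_of_nonneg_left ?_ hD
  have h2 := hlip x hx y hy x' hx' y' hy'
  have h3 : 0 ≤ max |x - x'| |y - y'| := le_max_of_le_left (abs_nonneg _)
  simp only [Prod.mk_sub_mk, Prod.norm_def, Real.norm_eq_abs]
  refine max_le ?_ (max_le ?_ ?_)
  · nlinarith [le_max_left |x - x'| |y - y'|]
  · nlinarith [le_max_right |x - x'| |y - y'|]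
  · nlinarith

/-! ### Partial derivatives of the pseudogradient step -/

theorem hasStrictFDerivAt_F (hm : G.StronglyMonotone μ κ) (hθ : θ ∈ G.Θ) (hx : x ∈ G.Ωx)
    (hy : y ∈ G.Ωy) (hz : z ∈ G.Ωz) :
    HasStrictFDerivAt (fun w => G.F x y w θ) (fderiv ℝ (fun w => G.F x y w θ) z) z := by
  have h1 := (hm.smooth θ hθ x hx y hy z hz).hasStrictFDerivAt one_ne_zero
  have h2 : HasStrictFDerivAt (fun w : Prof N => (x, y, w))
      ((0 : Prof N →L[ℝ] ℝ).prod ((0 : Prof N →L[ℝ] ℝ).prod (ContinuousLinearMap.id ℝ _))) z :=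
    (hasStrictFDerivAt_const x z).prodMk ((hasStrictFDerivAt_const y z).prodMk
      (hasStrictFDerivAt_id z))
  have h3 := HasStrictFDerivAt.comp (g := fun p : ℝ × ℝ × Prof N => G.F p.1 p.2.1 p.2.2 θ) z h1 h2
  have h4 := h3.hasFDerivAt.fderiv
  simp only at h3 h4
  rw [h4]
  exact h3

theorem hasDerivAt_F (hm : G.StronglyMonotone μ κ) (hθ : θ ∈ G.Θ) (hx : x ∈ G.Ωx)
    (hy : y ∈ G.Ωy) (hz : z ∈ G.Ωz) :
    HasDerivAt (fun x' => G.F x' y z θ)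
      (fderiv ℝ (fun p : ℝ × ℝ × Prof N => G.F p.1 p.2.1 p.2.2 θ) (x, y, z) (1, 0, 0)) x := by
  have h1 := ((hm.smooth θ hθ x hx y hy z hz).differentiableAt one_ne_zero).hasFDerivAt
  have h2 : HasDerivAt (fun x' : ℝ => (x', y, z)) (1, 0, 0) x :=
    (hasDerivAt_id x).prodMk (hasDerivAt_const x (y, z))
  exact HasFDerivAt.comp_hasDerivAt (l := fun p : ℝ × ℝ × Prof N => G.F p.1 p.2.1 p.2.2 θ) x h1 h2

theorem differentiableAt_omega_joint (hm : G.StronglyMonotone μ κ) (hθ : θ ∈ G.Θ) (hx : x ∈ G.Ωx)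
    (hy : y ∈ G.Ωy) (hz : z ∈ G.Ωz) :
    DifferentiableAt ℝ (fun p : ℝ × Prof N => G.omega γ p.1 y θ p.2) (x, z) := by
  have h1 := (hm.smooth θ hθ x hx y hy z hz).differentiableAt one_ne_zero
  have h2 : DifferentiableAt ℝ (fun p : ℝ × Prof N => (p.1, y, p.2)) (x, z) := by fun_prop
  have h3 := DifferentiableAt.comp (g := fun p : ℝ × ℝ × Prof N => G.F p.1 p.2.1 p.2.2 θ) (x, z)
    h1 h2
  exact differentiableAt_snd.sub (h3.const_smul γ)

theorem hasStrictFDerivAt_omega (hm : G.StronglyMonotone μ κ) (hθ : θ ∈ G.Θ) (hx : x ∈ G.Ωx)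
    (hy : y ∈ G.Ωy) (hz : z ∈ G.Ωz) :
    HasStrictFDerivAt (G.omega γ x y θ)
      (ContinuousLinearMap.id ℝ _ - γ • fderiv ℝ (fun w => G.F x y w θ) z) z :=
  (hasStrictFDerivAt_id z).sub ((hasStrictFDerivAt_F hm hθ hx hy hz).const_smul γ)

theorem hasDerivAt_omega (hm : G.StronglyMonotone μ κ) (hθ : θ ∈ G.Θ) (hx : x ∈ G.Ωx)
    (hy : y ∈ G.Ωy) (hz : z ∈ G.Ωz) :
    HasDerivAt (fun x' => G.omega γ x' y θ z) (-(γ • deriv (fun x' => G.F x' y z θ) x)) x := by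
  have h1 := (hasDerivAt_F hm hθ hx hy hz).differentiableAt.hasDerivAt
  exact (h1.const_smul γ).const_sub z

/-! ### Directions along the box of bottom-level strategies -/

/-- The directions parallel to the box `Ωz`: the coordinates in which the box degenerates
vanish. -/
def tangent (G : Game m N) : Submodule ℝ (Prof N) where
  carrier := {v | ∀ i, G.zmin i = G.zmax i → v i = 0}
  add_mem' := fun ha hb i hi => by simp [ha i hi, hb i hi]
  zero_mem' := fun i _ => by simp
  smul_mem' := fun c v hv i hi => by simp [hv i hi]

theorem sub_mem_tangent {w : Prof N} (hz : z ∈ G.Ωz) (hw : w ∈ G.Ωz) : z - w ∈ G.tangent := by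
  intro i hi
  have h1 := hz i
  have h2 := hw i
  rw [hi, Icc_self, mem_singleton_iff] at h1 h2
  simp [h1, h2]

/-- The centre of the box, from which every tangent direction can be followed for a while. -/
theorem exists_center (G : Game m N) :
    ∃ c ∈ G.Ωz, ∀ v ∈ G.tangent, ∃ r : ℝ, 0 < r ∧ c + r • v ∈ G.Ωz := by
  refine ⟨WithLp.toLp 2 fun i => (G.zmin i + G.zmax i) / 2, fun i => ?_, fun v hv => ?_⟩
  · have := G.hz i
    constructor <;> simp <;> linarith
  have h1 : ∀ i, ∀ᶠ r : ℝ in 𝓝[>] 0,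
      (G.zmin i + G.zmax i) / 2 + r * v i ∈ Icc (G.zmin i) (G.zmax i) := by
    intro i
    rcases (G.hz i).eq_or_lt with hi | hi
    · refine Eventually.of_forall fun r => ?_
      rw [hv i hi, hi]
      simp
    · have hc : Tendsto (fun r : ℝ => (G.zmin i + G.zmax i) / 2 + r * v i) (𝓝 0)
          (𝓝 ((G.zmin i + G.zmax i) / 2 + 0 * v i)) := by
        apply Continuous.tendsto
        fun_prop
      refine (hc.mono_left nhdsWithin_le_nhds).eventually (Icc_mem_nhds ?_ ?_) <;> linarith
  obtain ⟨r, hr, hr0⟩ := ((eventually_all.2 h1).and self_mem_nhdsWithin).exists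
  exact ⟨r, hr0, fun i => by simpa using hr i⟩

/-- A map that is `K`-Lipschitz on the box has strict derivatives of norm at most `K` along the box,
also at its boundary points: one follows a direction from points close to the given one on the
segment to the centre of the box. -/
theorem norm_le_of_hasStrictFDerivAt {f : Prof N → Prof N} {f' : Prof N →L[ℝ] Prof N} {K : ℝ}
    (hf : HasStrictFDerivAt f f' z) (hz : z ∈ G.Ωz)
    (hlip : ∀ v ∈ G.Ωz, ∀ w ∈ G.Ωz, ‖f v - f w‖ ≤ K * ‖v - w‖) {v : Prof N}
    (hv : v ∈ G.tangent) : ‖f' v‖ ≤ K * ‖v‖ := by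
  obtain ⟨c, hc, hdir⟩ := G.exists_center
  obtain ⟨r, hr, hcr⟩ := hdir v hv
  have hpath : ∀ w : Prof N, Tendsto (fun t : ℝ => z + t • (w - z)) (𝓝[>] 0) (𝓝 z) := by
    intro w
    have : Tendsto (fun t : ℝ => z + t • (w - z)) (𝓝 0) (𝓝 (z + (0 : ℝ) • (w - z))) := by
      apply Continuous.tendsto
      fun_prop
    simp only [zero_smul, add_zero] at this
    exact this.mono_left nhdsWithin_le_nhds
  have hmem : ∀ w ∈ G.Ωz, ∀ᶠ t : ℝ in 𝓝[>] 0, z + t • (w - z) ∈ G.Ωz := by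
    intro w hw
    filter_upwards [Ioo_mem_nhdsGT one_pos] with t ht
    exact G.convex_Ωz.add_smul_sub_mem hz hw ⟨ht.1.le, ht.2.le⟩
  rcases eq_or_ne v 0 with rfl | hv0
  · simp
  refine le_of_forall_pos_le_add fun δ hδ => ?_
  have hlo := hf.isLittleO.def (div_pos hδ (norm_pos_iff.2 hv0))
  have hev := ((hpath (c + r • v)).prodMk_nhds (hpath c)).eventually hlo
  obtain ⟨t, ⟨⟨ht1, ht2⟩, ht3⟩, ht0⟩ :=
    (((hev.and (hmem _ hcr)).and (hmem _ hc)).and self_mem_nhdsWithin).exists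
  have ht0' : 0 < t := ht0
  have hdiff : z + t • (c + r • v - z) - (z + t • (c - z)) = (t * r) • v := by
    module
  have hbound := hlip _ ht2 _ ht3
  simp only at ht1
  rw [hdiff] at ht1 hbound
  have hpos : 0 < t * r := mul_pos ht0' hr
  rw [map_smul] at ht1
  have h1 : ‖(t * r) • f' v‖ ≤ K * ‖(t * r) • v‖ + δ / ‖v‖ * ‖(t * r) • v‖ := by
    calc ‖(t * r) • f' v‖
        = ‖(f (z + t • (c + r • v - z)) - f (z + t • (c - z)))
            - (f (z + t • (c + r • v - z)) - f (z + t • (c - z)) - (t * r) • f' v)‖ := by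
          congr 1; abel
      _ ≤ _ := (norm_sub_le _ _).trans (add_le_add hbound ht1)
  rw [norm_smul, norm_smul, Real.norm_of_nonneg hpos.le] at h1
  have h2 : δ / ‖v‖ * ((t * r) * ‖v‖) = (t * r) * δ := by
    field_simp
  rw [h2] at h1
  nlinarith

/-! ### Bounds for the partial Jacobians of the projected step -/

theorem norm_fderiv_h_apply_le (hm : G.StronglyMonotone μ κ) (h0 : 0 < γ) (hθ : θ ∈ G.Θ)
    (hx : x ∈ G.Ωx) (hy : y ∈ G.Ωy) (hz : z ∈ G.Ωz) {v : Prof N} (hv : v ∈ G.tangent) :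
    ‖fderiv ℝ (G.h γ x y θ) z v‖ ≤ contr μ κ γ * ‖v‖ := by
  have hω := hasStrictFDerivAt_omega (γ := γ) hm hθ hx hy hz
  refine (norm_fderiv_apply_le_of_nonexpansive (g := G.omega γ x y θ)
    (fun w => G.norm_projZ_sub_le _ _) hω.hasFDerivAt v).trans ?_
  exact norm_le_of_hasStrictFDerivAt hω hz
    (fun v hv w hw => norm_omega_sub_le hm h0 hθ hx hy hv hw) hv

theorem norm_deriv_h_le (hm : G.StronglyMonotone μ κ) (h0 : 0 < γ) (hθ : θ ∈ G.Θ)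
    (hx : x ∈ G.Ωx) (hy : y ∈ G.Ωy) (hz : z ∈ G.Ωz) {C : ℝ}
    (hC : ∀ p ∈ G.joint, ‖fderiv ℝ (fun p : ℝ × ℝ × Prof N => G.F p.1 p.2.1 p.2.2 θ) p‖ ≤ C) :
    ‖deriv (fun x' => G.h γ x' y θ z) x‖ ≤ γ * C := by
  have hω := hasDerivAt_omega (γ := γ) hm hθ hx hy hz
  have h1 := norm_fderiv_apply_le_of_nonexpansive (f := fun x' => G.h γ x' y θ z)
    (fun w => G.norm_projZ_sub_le _ _) hω.hasFDerivAt 1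
  rw [fderiv_apply_one_eq_deriv] at h1
  refine h1.trans ?_
  rw [(hasDerivAt_F hm hθ hx hy hz).deriv]
  simp only [ContinuousLinearMap.toSpanSingleton_apply, one_smul, norm_neg, norm_smul,
    Real.norm_of_nonneg h0.le]
  refine mul_le_mul_of_nonneg_left ?_ h0.le
  refine (ContinuousLinearMap.le_opNorm _ _).trans ?_
  simpa [Prod.norm_def] using hC _ (mk_mem_joint hx hy hz)

theorem fderiv_h_apply_mem_tangent (z v : Prof N) :
    fderiv ℝ (G.h γ x y θ) z v ∈ G.tangent := by
  intro i hi
  by_cases hd : DifferentiableAt ℝ (G.h γ x y θ) z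
  · have h1 : HasFDerivAt (fun w => G.h γ x y θ w i)
        ((EuclideanSpace.proj i : Prof N →L[ℝ] ℝ).comp (fderiv ℝ (G.h γ x y θ) z)) z :=
      (EuclideanSpace.proj i : Prof N →L[ℝ] ℝ).hasFDerivAt.comp z hd.hasFDerivAt
    have h2 : (fun w => G.h γ x y θ w i) = fun _ => G.zmax i := by
      funext w
      have := h_mem (G := G) (γ := γ) (x := x) (y := y) (θ := θ) w i
      rw [hi, Icc_self, mem_singleton_iff] at this
      exact this
    rw [h2] at h1
    have h3 := h1.unique (hasFDerivAt_const _ _)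
    simpa using congrArg (fun A : Prof N →L[ℝ] ℝ => A v) h3
  · rw [fderiv_zero_of_not_differentiableAt hd]
    simp

theorem deriv_h_mem_tangent (z : Prof N) :
    deriv (fun x' => G.h γ x' y θ z) x ∈ G.tangent := by
  intro i hi
  by_cases hd : DifferentiableAt ℝ (fun x' => G.h γ x' y θ z) x
  · have h1 : HasDerivAt (fun x' => G.h γ x' y θ z i) (deriv (fun x' => G.h γ x' y θ z) x i) x :=
      (EuclideanSpace.proj i : Prof N →L[ℝ] ℝ).hasFDerivAt.comp_hasDerivAt x hd.hasDerivAt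
    have h2 : (fun x' => G.h γ x' y θ z i) = fun _ => G.zmax i := by
      funext x'
      have := h_mem (G := G) (γ := γ) (x := x') (y := y) (θ := θ) z i
      rw [hi, Icc_self, mem_singleton_iff] at this
      exact this
    rw [h2] at h1
    exact h1.unique (hasDerivAt_const _ _)
  · rw [deriv_zero_of_not_differentiableAt hd]
    simp

/-! ### The projection inside a region -/

/-- The linear part of the projection onto `Ωz` on the box with index `c`. -/
noncomputable def selector (c : Fin N → Fin 3) : Prof N →L[ℝ] Prof N :=
  LinearMap.toContinuousLinearMap
    { toFun := fun v => WithLp.toLp 2 fun i => if c i = 1 then v i else 0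
      map_add' := fun v w => by ext i; by_cases h : c i = 1 <;> simp [h]
      map_smul' := fun a v => by ext i; by_cases h : c i = 1 <;> simp [h] }

theorem selector_apply (c : Fin N → Fin 3) (v : Prof N) (i : Fin N) :
    selector c v i = if c i = 1 then v i else 0 := rfl

theorem norm_selector_le (c : Fin N → Fin 3) (v : Prof N) : ‖selector c v‖ ≤ ‖v‖ :=
  norm_le_of_abs_le fun i => by
    rw [selector_apply]
    split_ifs <;> simp

theorem projZ_sub_projZ {c : Fin N → Fin 3} {v w : Prof N} (hv : v ∈ G.region c)
    (hw : w ∈ G.region c) : G.projZ v - G.projZ w = selector c (v - w) := by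
  ext i
  have h1 := hv i
  have h2 := hw i
  have hz := G.hz i
  simp only [branch] at h1 h2
  simp only [projZ, PiLp.sub_apply, selector_apply]
  generalize hc : c i = j at *
  fin_cases j
  · simp only [Fin.zero_eta, Matrix.cons_val_zero, mem_Iic] at h1 h2
    rw [max_eq_left ((min_le_right _ _).trans h1), max_eq_left ((min_le_right _ _).trans h2)]
    simp
  · simp only [Fin.mk_one, Matrix.cons_val_one, Matrix.cons_val_zero] at h1 h2
    rw [clamp_of_mem h1, clamp_of_mem h2]
    simp
  · simp only [Fin.reduceFinMk, Matrix.cons_val, mem_Ici] at h1 h2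
    rw [min_eq_left h1, min_eq_left h2]
    simp

theorem hasFDerivAt_projZ {c : Fin N → Fin 3} {w : Prof N} (hw : w ∈ interior (G.region c)) :
    HasFDerivAt G.projZ (selector c) w := by
  have h1 : HasFDerivAt (fun v => G.projZ w + selector c (v - w)) (selector c) w := by
    have h2 : HasFDerivAt (fun v : Prof N => v - w) (ContinuousLinearMap.id ℝ _) w :=
      (hasFDerivAt_id w).sub_const w
    exact ((selector c).hasFDerivAt.comp w h2).const_add (G.projZ w)
  refine h1.congr_of_eventuallyEq ?_
  filter_upwards [mem_interior_iff_mem_nhds.1 hw] with v hv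
  rw [← projZ_sub_projZ hv (interior_subset hw)]
  abel

theorem hasFDerivAt_h (hm : G.StronglyMonotone μ κ) (hθ : θ ∈ G.Θ) (hx : x ∈ G.Ωx)
    (hy : y ∈ G.Ωy) (hz : z ∈ G.Ωz) {c : Fin N → Fin 3}
    (hc : G.omega γ x y θ z ∈ interior (G.region c)) :
    HasFDerivAt (G.h γ x y θ) ((selector c).comp
      (ContinuousLinearMap.id ℝ _ - γ • fderiv ℝ (fun w => G.F x y w θ) z)) z :=
  (hasFDerivAt_projZ hc).comp z (hasStrictFDerivAt_omega hm hθ hx hy hz).hasFDerivAt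

theorem hasDerivAt_h (hm : G.StronglyMonotone μ κ) (hθ : θ ∈ G.Θ) (hx : x ∈ G.Ωx)
    (hy : y ∈ G.Ωy) (hz : z ∈ G.Ωz) {c : Fin N → Fin 3}
    (hc : G.omega γ x y θ z ∈ interior (G.region c)) :
    HasDerivAt (fun x' => G.h γ x' y θ z)
      (selector c (-(γ • deriv (fun x' => G.F x' y z θ) x))) x :=
  HasFDerivAt.comp_hasDerivAt (l := G.projZ) x (hasFDerivAt_projZ hc)
    (hasDerivAt_omega hm hθ hx hy hz)

/-! ### The sensitivity of the equilibrium response -/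

/-- The linearized fixed-point equation is solvable, because the Jacobian of the projected step is a
contraction of the directions along the box. -/
theorem exists_sensitivity (hm : G.StronglyMonotone μ κ) (h0 : 0 < γ) (h1 : γ < 2 * μ / κ ^ 2)
    (hθ : θ ∈ G.Θ) (hx : x ∈ G.Ωx) (hy : y ∈ G.Ωy) (hz : z ∈ G.Ωz) :
    ∃ s ∈ G.tangent,
      s = deriv (fun x' => G.h γ x' y θ z) x + fderiv ℝ (G.h γ x y θ) z s := by
  have hη := contr_lt_one hm h0 h1
  let A : G.tangent →ₗ[ℝ] G.tangent :=
    (fderiv ℝ (G.h γ x y θ) z).toLinearMap.restrict fun v _ => fderiv_h_apply_mem_tangent z v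
  have hinj : Function.Injective (LinearMap.id - A : G.tangent →ₗ[ℝ] G.tangent) := by
    rw [injective_iff_map_eq_zero]
    rintro ⟨v, hv⟩ h
    have h2 : v = fderiv ℝ (G.h γ x y θ) z v := by
      have := congrArg Subtype.val h
      exact sub_eq_zero.1 this
    have h3 := norm_fderiv_h_apply_le hm h0 hθ hx hy hz hv
    rw [← h2] at h3
    have h4 : ‖v‖ = 0 := by nlinarith [norm_nonneg v]
    exact Subtype.ext (norm_eq_zero.1 h4)
  obtain ⟨s, hs⟩ := LinearMap.injective_iff_surjective.1 hinj
    ⟨deriv (fun x' => G.h γ x' y θ z) x, deriv_h_mem_tangent z⟩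
  refine ⟨s, s.2, ?_⟩
  have h5 : (s : Prof N) - fderiv ℝ (G.h γ x y θ) z s = deriv (fun x' => G.h γ x' y θ z) x :=
    congrArg Subtype.val hs
  rw [← h5]
  abel

/-- Where the projected step is smooth, the equilibrium response is differentiable relative to `Ωx`,
and its derivative solves the linearized fixed-point equation. -/
theorem hasDerivWithinAt_brZ (hs : G.ConcaveSmooth) (hm : G.StronglyMonotone μ κ) (h0 : 0 < γ)
    (h1 : γ < 2 * μ / κ ^ 2) (hθ : θ ∈ G.Θ) (hx : x ∈ G.Ωx) (hy : y ∈ G.Ωy) {c : Fin N → Fin 3}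
    (hc : G.omega γ x y θ (G.brZ x y θ) ∈ interior (G.region c)) {s : Prof N}
    (hsT : s ∈ G.tangent)
    (hsfix : s = deriv (fun x' => G.h γ x' y θ (G.brZ x y θ)) x
      + fderiv ℝ (G.h γ x y θ) (G.brZ x y θ) s) :
    HasDerivWithinAt (fun x' => G.brZ x' y θ) s G.Ωx x := by
  have hη := contr_lt_one hm h0 h1
  obtain ⟨C, hC, hlip⟩ := exists_lipschitz_brZ hs hm hθ
  set Z : ℝ → Prof N := fun x' => G.brZ x' y θ with hZ
  have hZm : ∀ x' ∈ G.Ωx, Z x' ∈ G.Ωz := fun x' hx' => brZ_mem hs hm hθ hx' hy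
  have hZlip : ∀ x' ∈ G.Ωx, ‖Z x' - Z x‖ ≤ C * |x' - x| := fun x' hx' => by
    simpa using hlip x' hx' y hy x hx y hy
  set H : ℝ × Prof N → Prof N := fun p => G.h γ p.1 y θ p.2 with hH
  have hHd : DifferentiableAt ℝ H (x, Z x) :=
    (hasFDerivAt_projZ hc).differentiableAt.comp (x, Z x)
      (differentiableAt_omega_joint hm hθ hx hy (hZm x hx))
  set D := fderiv ℝ H (x, Z x) with hD
  set u := deriv (fun x' => G.h γ x' y θ (Z x)) x with hu
  set A := fderiv ℝ (G.h γ x y θ) (Z x) with hA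
  have hDu : D (1, 0) = u := by
    have h2 : HasDerivAt (fun x' : ℝ => (x', Z x)) (1, 0) x :=
      (hasDerivAt_id x).prodMk (hasDerivAt_const x (Z x))
    exact (HasFDerivAt.comp_hasDerivAt (l := H) x hHd.hasFDerivAt h2).deriv.symm
  have hDA : ∀ v, D (0, v) = A v := fun v => by
    have h2 : HasFDerivAt (fun w : Prof N => (x, w))
        ((0 : Prof N →L[ℝ] ℝ).prod (ContinuousLinearMap.id ℝ _)) (Z x) :=
      (hasFDerivAt_const x (Z x)).prodMk (hasFDerivAt_id (Z x))
    have h3 := (HasFDerivAt.comp (g := H) (Z x) hHd.hasFDerivAt h2).fderiv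
    have h4 := congrArg (fun B : Prof N →L[ℝ] Prof N => B v) h3
    simp only [ContinuousLinearMap.comp_apply, ContinuousLinearMap.prod_apply, zero_apply,
      ContinuousLinearMap.id_apply] at h4
    exact h4.symm
  have hZc : ContinuousWithinAt Z G.Ωx x := by
    rw [ContinuousWithinAt, tendsto_iff_norm_sub_tendsto_zero]
    have h2 : Tendsto (fun x' => C * |x' - x|) (𝓝[G.Ωx] x) (𝓝 0) := by
      have : Tendsto (fun x' => C * |x' - x|) (𝓝 x) (𝓝 (C * |x - x|)) := by
        apply Continuous.tendsto
        fun_prop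
      simp only [sub_self, abs_zero, mul_zero] at this
      exact this.mono_left nhdsWithin_le_nhds
    refine squeeze_zero' (Eventually.of_forall fun _ => norm_nonneg _) ?_ h2
    filter_upwards [self_mem_nhdsWithin] with x' hx' using hZlip x' hx'
  have hpath : Tendsto (fun x' => (x', Z x')) (𝓝[G.Ωx] x) (𝓝 (x, Z x)) :=
    (tendsto_id.mono_left nhdsWithin_le_nhds).prodMk_nhds hZc
  rw [hasDerivWithinAt_iff_isLittleO]
  refine Asymptotics.isLittleO_iff.2 fun δ hδ => ?_
  have hδ' : 0 < δ * (1 - contr μ κ γ) / (1 + C) := by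
    have := sub_pos.2 hη
    positivity
  filter_upwards [hpath.eventually (hHd.hasFDerivAt.isLittleO.def hδ'), self_mem_nhdsWithin]
    with x' hx' hmem
  have hfix : ∀ x' ∈ G.Ωx, H (x', Z x') = Z x' := fun x' hx' => h_brZ hs hm h0 hθ hx' hy
  rw [hfix x' hmem, hfix x hx] at hx'
  -- the remainder is tangent to the box, where `1 - A` is bounded below by `1 - η`
  set R := Z x' - Z x - (x' - x) • s with hR
  have hRT : R ∈ G.tangent :=
    G.tangent.sub_mem (sub_mem_tangent (hZm x' hmem) (hZm x hx)) (G.tangent.smul_mem _ hsT)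
  have hsplit : D ((x', Z x') - (x, Z x)) = (x' - x) • u + A (Z x' - Z x) := by
    have : ((x', Z x') : ℝ × Prof N) - (x, Z x) = (x' - x) • (1, 0) + (0, Z x' - Z x) := by
      ext <;> simp
    rw [this, map_add, map_smul, hDu, hDA]
  have hRA : Z x' - Z x - D ((x', Z x') - (x, Z x)) = R - A R := by
    rw [hsplit, hR]
    simp only [map_sub, map_smul]
    have : u = s - A s := by
      rw [eq_sub_iff_add_eq]; exact hsfix.symm
    rw [this]
    module
  rw [hRA] at hx'
  have hnorm : ‖((x', Z x') : ℝ × Prof N) - (x, Z x)‖ ≤ (1 + C) * |x' - x| := by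
    rw [Prod.mk_sub_mk, Prod.norm_def, Real.norm_eq_abs]
    have h2 := hZlip x' hmem
    have h3 := abs_nonneg (x' - x)
    exact max_le (by nlinarith) (by nlinarith)
  have h2 : ‖R - A R‖ ≤ δ * (1 - contr μ κ γ) * |x' - x| := by
    refine hx'.trans ((mul_le_mul_of_nonneg_left hnorm hδ'.le).trans_eq ?_)
    field_simp
  have h3 : ‖A R‖ ≤ contr μ κ γ * ‖R‖ :=
    norm_fderiv_h_apply_le hm h0 hθ hx hy (hZm x hx) hRT
  have h4 := norm_sub_norm_le R (A R)
  rw [Real.norm_eq_abs]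
  have h5 : (1 - contr μ κ γ) * ‖R‖ ≤ (1 - contr μ κ γ) * (δ * |x' - x|) := by linarith
  exact le_of_mul_le_mul_left h5 (sub_pos.2 hη)

/-! ### The hypergradient -/

theorem hasDerivAt_UX (hs : G.ConcaveSmooth) (hx : x ∈ G.Ωx) (hy : y ∈ G.Ωy) (hz : z ∈ G.Ωz) :
    HasDerivAt (fun x' => G.UX x' y z)
      (fderiv ℝ (fun p : ℝ × ℝ × Prof N => G.UX p.1 p.2.1 p.2.2) (x, y, z) (1, 0, 0)) x := by
  have h1 := ((hs.UX_smooth x hx y hy z hz).differentiableAt one_ne_zero).hasFDerivAt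
  have h2 : HasDerivAt (fun x' : ℝ => (x', y, z)) (1, 0, 0) x :=
    (hasDerivAt_id x).prodMk (hasDerivAt_const x (y, z))
  exact HasFDerivAt.comp_hasDerivAt (l := fun p : ℝ × ℝ × Prof N => G.UX p.1 p.2.1 p.2.2) x h1 h2

theorem hasFDerivAt_UX (hs : G.ConcaveSmooth) (hx : x ∈ G.Ωx) (hy : y ∈ G.Ωy) (hz : z ∈ G.Ωz) :
    HasFDerivAt (fun w => G.UX x y w)
      ((fderiv ℝ (fun p : ℝ × ℝ × Prof N => G.UX p.1 p.2.1 p.2.2) (x, y, z)).comp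
        ((0 : Prof N →L[ℝ] ℝ).prod ((0 : Prof N →L[ℝ] ℝ).prod (ContinuousLinearMap.id ℝ _))))
      z := by
  have h1 := ((hs.UX_smooth x hx y hy z hz).differentiableAt one_ne_zero).hasFDerivAt
  have h2 : HasFDerivAt (fun w : Prof N => (x, y, w))
      ((0 : Prof N →L[ℝ] ℝ).prod ((0 : Prof N →L[ℝ] ℝ).prod (ContinuousLinearMap.id ℝ _))) z :=
    (hasFDerivAt_const x z).prodMk ((hasFDerivAt_const y z).prodMk (hasFDerivAt_id z))
  exact HasFDerivAt.comp (g := fun p : ℝ × ℝ × Prof N => G.UX p.1 p.2.1 p.2.2) z h1 h2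

theorem hypergrad_eq (hs : G.ConcaveSmooth) (hx : x ∈ G.Ωx) (hy : y ∈ G.Ωy) (hz : z ∈ G.Ωz)
    (s : Prof N) : G.hypergrad x y z s =
      fderiv ℝ (fun p : ℝ × ℝ × Prof N => G.UX p.1 p.2.1 p.2.2) (x, y, z) (1, 0, s) := by
  rw [hypergrad, (hasDerivAt_UX hs hx hy hz).deriv, (hasFDerivAt_UX hs hx hy hz).fderiv]
  simp only [ContinuousLinearMap.comp_apply, ContinuousLinearMap.prod_apply,
    zero_apply, ContinuousLinearMap.id_apply]
  rw [← map_add]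
  simp

theorem hasDerivWithinAt_Ured (hs : G.ConcaveSmooth) (hm : G.StronglyMonotone μ κ) (hθ : θ ∈ G.Θ)
    (hx : x ∈ G.Ωx) (hy : y ∈ G.Ωy) {s : Prof N}
    (hd : HasDerivWithinAt (fun x' => G.brZ x' y θ) s G.Ωx x) :
    HasDerivWithinAt (fun x' => G.Ured x' y θ) (G.hypergrad x y (G.brZ x y θ) s) G.Ωx x := by
  have hz := brZ_mem hs hm hθ hx hy
  rw [hypergrad_eq hs hx hy hz]
  have h1 := ((hs.UX_smooth x hx y hy _ hz).differentiableAt one_ne_zero).hasFDerivAt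
  have h2 : HasDerivWithinAt (fun x' : ℝ => (x', y, G.brZ x' y θ)) (1, 0, s) G.Ωx x :=
    (hasDerivWithinAt_id x _).prodMk ((hasDerivWithinAt_const x _ y).prodMk hd)
  exact HasFDerivAt.comp_hasDerivWithinAt
    (l := fun p : ℝ × ℝ × Prof N => G.UX p.1 p.2.1 p.2.2) x h1 h2

theorem exists_abs_hypergrad_le (hs : G.ConcaveSmooth) :
    ∃ C : ℝ, 0 ≤ C ∧ ∀ x ∈ G.Ωx, ∀ y ∈ G.Ωy, ∀ z ∈ G.Ωz, ∀ s : Prof N,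
      |G.hypergrad x y z s| ≤ C * (1 + ‖s‖) := by
  obtain ⟨C, hC, hb, -⟩ := exists_bound_UX hs
  refine ⟨C, hC, fun x hx y hy z hz s => ?_⟩
  rw [hypergrad_eq hs hx hy hz, ← Real.norm_eq_abs]
  refine (ContinuousLinearMap.le_opNorm _ _).trans
    (mul_le_mul (hb _ (mk_mem_joint hx hy hz)) ?_ (norm_nonneg _) hC)
  simp only [Prod.norm_def, norm_one, norm_zero]
  have := norm_nonneg s
  exact max_le (by linarith) (max_le (by linarith) (by linarith))

/-- The interaction term `f₁` inherits its regularity from `U_X`: it is the slope of `U_X` in `x`,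
up to a term that depends on `x` only. -/
theorem f₁_sub_mul (y : ℝ) (z z' : Prof N) : (G.f₁ y z - G.f₁ y z') * (G.xmax - G.xmin) =
    (G.UX G.xmax y z - G.UX G.xmax y z') - (G.UX G.xmin y z - G.UX G.xmin y z') := by
  simp only [UX]
  ring

theorem differentiableAt_f₁ (hs : G.ConcaveSmooth) (hy : y ∈ G.Ωy) (hz : z ∈ G.Ωz) :
    DifferentiableAt ℝ (G.f₁ y) z := by
  have hx1 : G.xmax ∈ G.Ωx := ⟨G.hx.le, le_rfl⟩
  have hx2 : G.xmin ∈ G.Ωx := ⟨le_rfl, G.hx.le⟩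
  have h1 := (hasFDerivAt_UX hs hx1 hy hz).differentiableAt
  have h2 := (hasFDerivAt_UX hs hx2 hy hz).differentiableAt
  have h3 : G.f₁ y = fun w => G.f₁ y z + ((G.UX G.xmax y w - G.UX G.xmax y z) -
      (G.UX G.xmin y w - G.UX G.xmin y z)) * (G.xmax - G.xmin)⁻¹ := by
    funext w
    rw [← f₁_sub_mul, mul_assoc, mul_inv_cancel₀ (sub_pos.2 G.hx).ne']
    ring
  rw [h3]
  fun_prop

theorem exists_lipschitz_hypergrad (hs : G.ConcaveSmooth) (hr : G.Regular) :
    ∃ C : ℝ, 0 ≤ C ∧ ∀ x ∈ G.Ωx, ∀ y ∈ G.Ωy, ∀ z ∈ G.Ωz, ∀ z' ∈ G.Ωz, ∀ s s' : Prof N,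
      |G.hypergrad x y z s - G.hypergrad x y z' s'|
        ≤ C * ((1 + ‖s'‖) * ‖z - z'‖ + ‖s - s'‖) := by
  obtain ⟨C, hC, hb, hlip⟩ := exists_bound_UX hs
  obtain ⟨K, hK⟩ := hr.f₁_lipschitz
  set X := max |G.xmin| |G.xmax| with hX
  have hX0 : 0 ≤ X := le_max_of_le_left (abs_nonneg _)
  have hgap := sub_pos.2 G.hx
  set C1 := 2 * C / (G.xmax - G.xmin) with hC1
  have hC10 : 0 ≤ C1 := by positivity
  refine ⟨C1 + X * K + C, by positivity, fun x hx y hy z hz z' hz' s s' => ?_⟩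
  have hlipz : ∀ x ∈ G.Ωx, |G.UX x y z - G.UX x y z'| ≤ C * ‖z - z'‖ := fun x hx => by
    have := hlip (x, y, z) ⟨hx, hy, hz⟩ (x, y, z') ⟨hx, hy, hz'⟩
    simpa [Prod.norm_def] using this
  have hf : |G.f₁ y z - G.f₁ y z'| ≤ C1 * ‖z - z'‖ := by
    rw [hC1, div_mul_eq_mul_div, le_div_iff₀ hgap]
    have h1 := congrArg abs (f₁_sub_mul (G := G) y z z')
    rw [abs_mul, abs_of_pos hgap] at h1
    rw [h1]
    refine (abs_sub _ _).trans ?_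
    have h2 := hlipz G.xmax ⟨G.hx.le, le_rfl⟩
    have h3 := hlipz G.xmin ⟨le_rfl, G.hx.le⟩
    linarith
  have hd1 : deriv (fun x' => G.UX x' y z) x
      = deriv (fun x' => G.UX x' y z') x + (G.f₁ y z - G.f₁ y z') := by
    have h1 := ((hasDerivAt_UX hs hx hy hz').differentiableAt.hasDerivAt).add
      ((hasDerivAt_id x).const_mul (G.f₁ y z - G.f₁ y z'))
    have h2 : (fun x' => G.UX x' y z)
        = (fun x' => G.UX x' y z') + fun x' => (G.f₁ y z - G.f₁ y z') * id x' := by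
      funext x'
      simp only [UX, Pi.add_apply, id]
      ring
    rw [h2, h1.deriv, mul_one]
  have hfd : ∀ w ∈ G.Ωz, fderiv ℝ (fun w => G.UX x y w) w = x • fderiv ℝ (G.f₁ y) w := by
    intro w hw
    exact (((differentiableAt_f₁ hs hy hw).hasFDerivAt.mul_const x).const_add _).fderiv
  have hgz : ‖fderiv ℝ (fun w => G.UX x y w) z‖ ≤ C := by
    rw [(hasFDerivAt_UX hs hx hy hz).fderiv]
    refine ContinuousLinearMap.opNorm_le_bound _ hC fun v => ?_
    rw [ContinuousLinearMap.comp_apply]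
    refine (ContinuousLinearMap.le_opNorm _ _).trans
      (mul_le_mul (hb _ (mk_mem_joint hx hy hz)) ?_ (norm_nonneg _) hC)
    simp [Prod.norm_def]
  have hsplit : G.hypergrad x y z s - G.hypergrad x y z' s'
      = (G.f₁ y z - G.f₁ y z') + fderiv ℝ (fun w => G.UX x y w) z (s - s')
        + x * ((fderiv ℝ (G.f₁ y) z - fderiv ℝ (G.f₁ y) z') s') := by
    have h1 : x * ((fderiv ℝ (G.f₁ y) z - fderiv ℝ (G.f₁ y) z') s')
        = fderiv ℝ (fun w => G.UX x y w) z s' - fderiv ℝ (fun w => G.UX x y w) z' s' := by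
      rw [hfd z hz, hfd z' hz']
      simp [mul_sub]
    rw [h1, hypergrad, hypergrad, hd1, map_sub]
    ring
  have hx' : |x| ≤ X := abs_le_max_abs_abs hx.1 hx.2
  have e1 : |fderiv ℝ (fun w => G.UX x y w) z (s - s')| ≤ C * ‖s - s'‖ := by
    rw [← Real.norm_eq_abs]
    exact ContinuousLinearMap.le_of_opNorm_le _ hgz _
  have e2 : |x * ((fderiv ℝ (G.f₁ y) z - fderiv ℝ (G.f₁ y) z') s')|
      ≤ X * (K * ‖z - z'‖ * ‖s'‖) := by
    rw [abs_mul]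
    refine mul_le_mul hx' ?_ (abs_nonneg _) hX0
    rw [← Real.norm_eq_abs]
    refine ContinuousLinearMap.le_of_opNorm_le _ ?_ _
    have := (hK y hy).dist_le_mul z hz z' hz'
    rwa [dist_eq_norm, dist_eq_norm] at this
  rw [hsplit]
  refine (abs_add_three _ _ _).trans ?_
  have p1 := norm_nonneg (z - z')
  have p2 := norm_nonneg s'
  have p3 := norm_nonneg (s - s')
  have p4 : 0 ≤ X * (K : ℝ) := by positivity
  nlinarith [mul_nonneg hC10 (mul_nonneg p2 p1), mul_nonneg p4 p1, mul_nonneg p4 p3,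
    mul_nonneg hC10 p3, mul_nonneg hC p1, mul_nonneg hC (mul_nonneg p2 p1)]

/-! ### The inner loop -/

theorem iterate_h_mem (hz : z ∈ G.Ωz) (n : ℕ) : (G.h γ x y θ)^[n] z ∈ G.Ωz := by
  cases n with
  | zero => exact hz
  | succ n => rw [Function.iterate_succ_apply']; exact h_mem _

theorem norm_iterate_h_sub_le (hm : G.StronglyMonotone μ κ) (h0 : 0 < γ) (hθ : θ ∈ G.Θ)
    (hx : x ∈ G.Ωx) (hy : y ∈ G.Ωy) {w : Prof N} (hz : z ∈ G.Ωz) (hw : w ∈ G.Ωz) (n : ℕ) :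
    ‖(G.h γ x y θ)^[n] z - (G.h γ x y θ)^[n] w‖ ≤ contr μ κ γ ^ n * ‖z - w‖ := by
  induction n with
  | zero => simp
  | succ n ih =>
    rw [Function.iterate_succ_apply', Function.iterate_succ_apply', pow_succ']
    refine (norm_h_sub_le hm h0 hθ hx hy (iterate_h_mem hz n) (iterate_h_mem hw n)).trans ?_
    rw [mul_assoc]
    exact mul_le_mul_of_nonneg_left ih (contr_nonneg _ _ _)

theorem norm_iterate_succ_sub_le (hm : G.StronglyMonotone μ κ) (h0 : 0 < γ) (hθ : θ ∈ G.Θ)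
    (hx : x ∈ G.Ωx) (hy : y ∈ G.Ωy) (hz : z ∈ G.Ωz) (n : ℕ) :
    ‖(G.h γ x y θ)^[n + 1] z - (G.h γ x y θ)^[n] z‖
      ≤ contr μ κ γ ^ n * ‖G.h γ x y θ z - z‖ := by
  rw [Function.iterate_succ_apply]
  exact norm_iterate_h_sub_le hm h0 hθ hx hy (h_mem z) hz n

theorem warmStops_nonempty (hm : G.StronglyMonotone μ κ) (h0 : 0 < γ) (h1 : γ < 2 * μ / κ ^ 2)
    (hθ : θ ∈ G.Θ) (hx : x ∈ G.Ωx) (hy : y ∈ G.Ωy) (hz : z ∈ G.Ωz) (hσ : 0 < σ) :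
    (G.warmStops γ x y θ z σ).Nonempty := by
  have hlim := (tendsto_pow_atTop_nhds_zero_of_lt_one (contr_nonneg μ κ γ)
    (contr_lt_one hm h0 h1)).mul_const ‖G.h γ x y θ z - z‖
  rw [zero_mul] at hlim
  obtain ⟨n, hn⟩ := (hlim.eventually (gt_mem_nhds hσ)).exists
  exact ⟨n + 1, by omega, (norm_iterate_succ_sub_le hm h0 hθ hx hy hz n).trans hn.le⟩

theorem sensStops_nonempty (hm : G.StronglyMonotone μ κ) (h0 : 0 < γ) (h1 : γ < 2 * μ / κ ^ 2)
    (hθ : θ ∈ G.Θ) (hx : x ∈ G.Ωx) (hy : y ∈ G.Ωy) (hz : z ∈ G.Ωz) (hσ : 0 < σ) :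
    (G.sensStops (contr μ κ γ) γ x y θ z σ).Nonempty := by
  have hη0 := contr_nonneg μ κ γ
  have hη1 := contr_lt_one hm h0 h1
  set η := contr μ κ γ with hη
  set D := ‖G.h γ x y θ z - z‖ with hD
  have hpow := tendsto_pow_atTop_nhds_zero_of_lt_one hη0 hη1
  have hsum : Tendsto (fun l : ℕ => (l : ℝ) * η ^ l * D + η ^ l * D) atTop (𝓝 0) := by
    simpa using ((tendsto_self_mul_const_pow_of_lt_one hη0 hη1).mul_const D).add
      (hpow.mul_const D)
  obtain ⟨l, ⟨hl1, hl2⟩, hl3⟩ := (((hpow.eventually (gt_mem_nhds hσ)).and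
    (hsum.eventually (gt_mem_nhds hσ))).and (eventually_ge_atTop 1)).exists
  refine ⟨l, hl3, max_le hl1.le (le_trans ?_ hl2.le)⟩
  have : ∀ j ∈ Finset.range (l + 1),
      η ^ (l - j) * ‖(G.h γ x y θ)^[j + 1] z - (G.h γ x y θ)^[j] z‖ ≤ η ^ l * D := by
    intro j hj
    have hj' := Finset.mem_range.1 hj
    calc η ^ (l - j) * ‖(G.h γ x y θ)^[j + 1] z - (G.h γ x y θ)^[j] z‖
        ≤ η ^ (l - j) * (η ^ j * D) := mul_le_mul_of_nonneg_left
          (norm_iterate_succ_sub_le hm h0 hθ hx hy hz j) (pow_nonneg hη0 _)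
      _ = η ^ l * D := by rw [← mul_assoc, ← pow_add, Nat.sub_add_cancel (by omega)]
  refine (Finset.sum_le_card_nsmul _ _ _ this).trans_eq ?_
  simp
  ring

theorem warm_mem (hz : z ∈ G.Ωz) : G.warm γ x y θ z σ ∈ G.Ωz := iterate_h_mem hz _

theorem innerStops (hm : G.StronglyMonotone μ κ) (h0 : 0 < γ) (h1 : γ < 2 * μ / κ ^ 2)
    (hθ : θ ∈ G.Θ) (hx : x ∈ G.Ωx) (hy : y ∈ G.Ωy) (hz : z ∈ G.Ωz) (hσ : 0 < σ) :
    G.InnerStops (contr μ κ γ) γ x y θ z σ :=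
  ⟨warmStops_nonempty hm h0 h1 hθ hx hy hz hσ,
    sensStops_nonempty hm h0 h1 hθ hx hy (warm_mem hz) hσ⟩

/-- A contraction displaces a point by a definite fraction of its distance to the fixed point. -/
theorem norm_sub_brZ_le (hs : G.ConcaveSmooth) (hm : G.StronglyMonotone μ κ) (h0 : 0 < γ)
    (h1 : γ < 2 * μ / κ ^ 2) (hθ : θ ∈ G.Θ) (hx : x ∈ G.Ωx) (hy : y ∈ G.Ωy) (hz : z ∈ G.Ωz) :
    ‖z - G.brZ x y θ‖ ≤ ‖G.h γ x y θ z - z‖ / (1 - contr μ κ γ) := by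
  rw [le_div_iff₀ (sub_pos.2 (contr_lt_one hm h0 h1))]
  have h2 := norm_h_sub_le hm h0 hθ hx hy hz (brZ_mem hs hm hθ hx hy)
  rw [h_brZ hs hm h0 hθ hx hy] at h2
  have h3 := norm_sub_le_norm_sub_add_norm_sub z (G.h γ x y θ z) (G.brZ x y θ)
  rw [norm_sub_rev z (G.h γ x y θ z)] at h3
  linarith

theorem norm_iterate_sub_brZ_le (hs : G.ConcaveSmooth) (hm : G.StronglyMonotone μ κ) (h0 : 0 < γ)
    (hθ : θ ∈ G.Θ) (hx : x ∈ G.Ωx) (hy : y ∈ G.Ωy) (hz : z ∈ G.Ωz) (n : ℕ) :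
    ‖(G.h γ x y θ)^[n] z - G.brZ x y θ‖ ≤ contr μ κ γ ^ n * ‖z - G.brZ x y θ‖ := by
  have h2 := norm_iterate_h_sub_le hm h0 hθ hx hy hz (brZ_mem hs hm hθ hx hy) n
  rwa [Function.iterate_fixed (h_brZ hs hm h0 hθ hx hy)] at h2

theorem norm_warm_sub_brZ_le (hs : G.ConcaveSmooth) (hm : G.StronglyMonotone μ κ) (h0 : 0 < γ)
    (h1 : γ < 2 * μ / κ ^ 2) (hθ : θ ∈ G.Θ) (hx : x ∈ G.Ωx) (hy : y ∈ G.Ωy) (hz : z ∈ G.Ωz)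
    (hσ : 0 < σ) :
    ‖G.warm γ x y θ z σ - G.brZ x y θ‖ ≤ σ / (1 - contr μ κ γ) := by
  obtain ⟨hn1, hn2⟩ := Nat.sInf_mem (warmStops_nonempty hm h0 h1 hθ hx hy hz hσ)
  have hη := contr_lt_one hm h0 h1
  rw [warm]
  set n := sInf (G.warmStops γ x y θ z σ)
  obtain ⟨k, hk⟩ : ∃ k, n = k + 1 := ⟨n - 1, by omega⟩
  rw [hk, add_tsub_cancel_right, Function.iterate_succ_apply'] at hn2
  rw [hk, Function.iterate_succ_apply']
  have hk' := iterate_h_mem (γ := γ) (x := x) (y := y) (θ := θ) hz k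
  have h2 := norm_sub_brZ_le hs hm h0 h1 hθ hx hy hk'
  have h3 := norm_h_sub_le hm h0 hθ hx hy hk' (brZ_mem hs hm hθ hx hy)
  rw [h_brZ hs hm h0 hθ hx hy] at h3
  refine (h3.trans (mul_le_of_le_one_left (norm_nonneg _) hη.le)).trans (h2.trans ?_)
  exact div_le_div_of_nonneg_right hn2 (sub_pos.2 hη).le

/-- The sensitivity iterates are tangent to the box after the first step. -/
theorem sens_succ_mem_tangent (l : ℕ) : G.sens γ x y θ z s (l + 1) ∈ G.tangent :=
  G.tangent.add_mem (deriv_h_mem_tangent _) (fderiv_h_apply_mem_tangent _ _)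

theorem sens_mem_tangent (hsT : s ∈ G.tangent) (l : ℕ) : G.sens γ x y θ z s l ∈ G.tangent := by
  cases l with
  | zero => exact hsT
  | succ l => exact sens_succ_mem_tangent l

theorem norm_sens_le (hm : G.StronglyMonotone μ κ) (h0 : 0 < γ) (hθ : θ ∈ G.Θ) (hx : x ∈ G.Ωx)
    (hy : y ∈ G.Ωy) (hz : z ∈ G.Ωz) {C R : ℝ}
    (hC : ∀ p ∈ G.joint, ‖fderiv ℝ (fun p : ℝ × ℝ × Prof N => G.F p.1 p.2.1 p.2.2 θ) p‖ ≤ C)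
    (hR : γ * C ≤ (1 - contr μ κ γ) * R) (hsT : s ∈ G.tangent) (hsR : ‖s‖ ≤ R) (l : ℕ) :
    ‖G.sens γ x y θ z s l‖ ≤ R := by
  induction l with
  | zero => exact hsR
  | succ l ih =>
    have hz' := iterate_h_mem (γ := γ) (x := x) (y := y) (θ := θ) hz (l + 1)
    have h1 := norm_deriv_h_le hm h0 hθ hx hy hz' hC
    have h2 := norm_fderiv_h_apply_le hm h0 hθ hx hy hz'
      (sens_mem_tangent (γ := γ) (x := x) (y := y) (θ := θ) (z := z) hsT l)
    have h3 := mul_le_mul_of_nonneg_left ih (contr_nonneg μ κ γ)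
    rw [sens]
    refine (norm_add_le _ _).trans ?_
    linarith

/-- One step of the sensitivity recursion. As long as the pseudogradient step stays in the smoothness
region of the equilibrium the Jacobians are off by a multiple of the distance to the equilibrium.
Otherwise they are merely bounded, but this happens only while `1 ≤ η ^ (j + 1) / (1 - η)`. -/
theorem norm_sens_succ_sub_le (hs : G.ConcaveSmooth) (hm : G.StronglyMonotone μ κ) (h0 : 0 < γ)
    (h1 : γ < 2 * μ / κ ^ 2) (hθ : θ ∈ G.Θ) (hx : x ∈ G.Ωx) (hy : y ∈ G.Ωy) (hz : z ∈ G.Ωz)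
    {C R LF : ℝ}
    (hC : ∀ p ∈ G.joint, ‖fderiv ℝ (fun p : ℝ × ℝ × Prof N => G.F p.1 p.2.1 p.2.2 θ) p‖ ≤ C)
    (hC0 : 0 ≤ C) (hLF0 : 0 ≤ LF)
    (hLF : ∀ z ∈ G.Ωz, ∀ z' ∈ G.Ωz,
      ‖deriv (fun x' => G.F x' y z θ) x - deriv (fun x' => G.F x' y z' θ) x‖ ≤ LF * ‖z - z'‖ ∧
      ‖fderiv ℝ (fun w => G.F x y w θ) z - fderiv ℝ (fun w => G.F x y w θ) z'‖ ≤ LF * ‖z - z'‖)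
    (hσ : 0 < σ) (hwarm : ‖z - G.brZ x y θ‖ ≤ σ / (1 - contr μ κ γ)) {c : Fin N → Fin 3}
    (hball : ∀ w, ‖w - G.omega γ x y θ (G.brZ x y θ)‖ ≤ σ → w ∈ interior (G.region c))
    {t : Prof N} (htT : t ∈ G.tangent) (htR : ‖t‖ ≤ R)
    (htfix : t = deriv (fun x' => G.h γ x' y θ (G.brZ x y θ)) x
      + fderiv ℝ (G.h γ x y θ) (G.brZ x y θ) t)
    (hsT : s ∈ G.tangent) (j : ℕ) :
    ‖G.sens γ x y θ z s (j + 1) - t‖ ≤ contr μ κ γ * ‖G.sens γ x y θ z s j - t‖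
      + (γ * LF * (1 + R) / (1 - contr μ κ γ)
          * ‖(G.h γ x y θ)^[(j + 1) + 1] z - (G.h γ x y θ)^[j + 1] z‖
        + 2 * (γ * C + R) / (1 - contr μ κ γ) ^ 2 * (contr μ κ γ ^ (j + 1)) ^ 2) := by
  have hη0 := contr_nonneg μ κ γ
  have hη1 := contr_lt_one hm h0 h1
  set η := contr μ κ γ with hη
  have hη' := sub_pos.2 hη1
  have hR0 : 0 ≤ R := (norm_nonneg _).trans htR
  set zs := G.brZ x y θ with hzs
  have hzsm : zs ∈ G.Ωz := brZ_mem hs hm hθ hx hy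
  set z1 := (G.h γ x y θ)^[j + 1] z with hz1
  have hz1m : z1 ∈ G.Ωz := iterate_h_mem hz _
  set sj := G.sens γ x y θ z s j with hsj
  have hsjT : sj ∈ G.tangent := sens_mem_tangent hsT j
  have hsplit : G.sens γ x y θ z s (j + 1) - t
      = fderiv ℝ (G.h γ x y θ) z1 (sj - t)
        + ((deriv (fun x' => G.h γ x' y θ z1) x - deriv (fun x' => G.h γ x' y θ zs) x)
          + (fderiv ℝ (G.h γ x y θ) z1 t - fderiv ℝ (G.h γ x y θ) zs t)) := by
    conv_lhs => rw [htfix]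
    rw [sens, map_sub]
    abel
  rw [hsplit]
  refine (norm_add_le _ _).trans (add_le_add ?_ ?_)
  · exact norm_fderiv_h_apply_le hm h0 hθ hx hy hz1m (G.tangent.sub_mem hsjT htT)
  have hd0 : 0 ≤ γ * LF * (1 + R) / (1 - η)
      * ‖(G.h γ x y θ)^[(j + 1) + 1] z - (G.h γ x y θ)^[j + 1] z‖ := by positivity
  have hb0 : 0 ≤ 2 * (γ * C + R) / (1 - η) ^ 2 * (η ^ (j + 1)) ^ 2 := by positivity
  by_cases hgood : ‖G.omega γ x y θ z1 - G.omega γ x y θ zs‖ ≤ σ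
  · refine le_trans ?_ (le_add_of_nonneg_right hb0)
    have hreg1 := hball _ hgood
    have hregs := hball _ (show ‖G.omega γ x y θ zs - G.omega γ x y θ zs‖ ≤ σ by simpa using hσ.le)
    obtain ⟨hLx, hLz⟩ := hLF z1 hz1m zs hzsm
    rw [(hasDerivAt_h hm hθ hx hy hz1m hreg1).deriv, (hasDerivAt_h hm hθ hx hy hzsm hregs).deriv,
      (hasFDerivAt_h hm hθ hx hy hz1m hreg1).fderiv, (hasFDerivAt_h hm hθ hx hy hzsm hregs).fderiv]
    set u1 := deriv (fun x' => G.F x' y z1 θ) x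
    set us := deriv (fun x' => G.F x' y zs θ) x
    set A1 := fderiv ℝ (fun w => G.F x y w θ) z1
    set As := fderiv ℝ (fun w => G.F x y w θ) zs
    have e1 : ‖selector c (-(γ • u1)) - selector c (-(γ • us))‖ ≤ γ * (LF * ‖z1 - zs‖) := by
      rw [← map_sub]
      refine (norm_selector_le _ _).trans ?_
      rw [show -(γ • u1) - -(γ • us) = -(γ • (u1 - us)) by module, norm_neg, norm_smul,
        Real.norm_of_nonneg h0.le]
      exact mul_le_mul_of_nonneg_left hLx h0.le
    have e2 : ‖(selector c).comp (ContinuousLinearMap.id ℝ (Prof N) - γ • A1) t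
        - (selector c).comp (ContinuousLinearMap.id ℝ (Prof N) - γ • As) t‖
        ≤ γ * (LF * ‖z1 - zs‖ * R) := by
      rw [ContinuousLinearMap.comp_apply, ContinuousLinearMap.comp_apply, ← map_sub]
      refine (norm_selector_le _ _).trans ?_
      have : (ContinuousLinearMap.id ℝ (Prof N) - γ • A1) t - (ContinuousLinearMap.id ℝ (Prof N) - γ • As) t
          = -(γ • ((A1 - As) t)) := by
        simp only [sub_apply, ContinuousLinearMap.id_apply, smul_apply]
        module
      rw [this, norm_neg, norm_smul, Real.norm_of_nonneg h0.le]
      refine mul_le_mul_of_nonneg_left ?_ h0.le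
      exact (ContinuousLinearMap.le_of_opNorm_le _ hLz _).trans
        (mul_le_mul_of_nonneg_left htR (by positivity))
    have e3 : ‖z1 - zs‖
        ≤ ‖(G.h γ x y θ)^[(j + 1) + 1] z - (G.h γ x y θ)^[j + 1] z‖ / (1 - η) := by
      rw [Function.iterate_succ_apply' _ (j + 1)]
      exact norm_sub_brZ_le hs hm h0 h1 hθ hx hy hz1m
    refine (norm_add_le _ _).trans ((add_le_add e1 e2).trans ?_)
    calc γ * (LF * ‖z1 - zs‖) + γ * (LF * ‖z1 - zs‖ * R) = γ * LF * (1 + R) * ‖z1 - zs‖ := by ring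
      _ ≤ γ * LF * (1 + R)
          * (‖(G.h γ x y θ)^[(j + 1) + 1] z - (G.h γ x y θ)^[j + 1] z‖ / (1 - η)) :=
        mul_le_mul_of_nonneg_left e3 (by positivity)
      _ = _ := by ring
  · refine le_trans ?_ (le_add_of_nonneg_left hd0)
    rw [not_le] at hgood
    have hone : 1 ≤ η ^ (j + 1) / (1 - η) := by
      have e1 := norm_omega_sub_le hm h0 hθ hx hy hz1m hzsm
      have e2 := norm_iterate_sub_brZ_le hs hm h0 hθ hx hy hz (j + 1)
      have e3 : ‖z1 - zs‖ ≤ η ^ (j + 1) * (σ / (1 - η)) :=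
        e2.trans (mul_le_mul_of_nonneg_left hwarm (pow_nonneg hη0 _))
      have e4 : σ < η ^ (j + 1) * (σ / (1 - η)) :=
        hgood.trans_le (e1.trans ((mul_le_of_le_one_left (norm_nonneg _) hη1.le).trans e3))
      have e5 : σ * 1 < σ * (η ^ (j + 1) / (1 - η)) := by
        rw [mul_one]
        refine e4.trans_eq ?_
        ring
      exact (lt_of_mul_lt_mul_left e5 hσ.le).le
    have hone2 : 1 ≤ (η ^ (j + 1) / (1 - η)) ^ 2 := one_le_pow₀ hone
    have b1 := norm_deriv_h_le hm h0 hθ hx hy hz1m hC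
    have b2 := norm_deriv_h_le hm h0 hθ hx hy hzsm hC
    have b3 := norm_fderiv_h_apply_le hm h0 hθ hx hy hz1m htT
    have b4 := norm_fderiv_h_apply_le hm h0 hθ hx hy hzsm htT
    have b5 : contr μ κ γ * ‖t‖ ≤ R :=
      (mul_le_of_le_one_left (norm_nonneg _) hη1.le).trans htR
    have b6 := norm_sub_le (deriv (fun x' => G.h γ x' y θ z1) x)
      (deriv (fun x' => G.h γ x' y θ zs) x)
    have b7 := norm_sub_le (fderiv ℝ (G.h γ x y θ) z1 t) (fderiv ℝ (G.h γ x y θ) zs t)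
    refine (norm_add_le _ _).trans ?_
    calc _ ≤ 2 * (γ * C + R) * 1 := by linarith
      _ ≤ 2 * (γ * C + R) * (η ^ (j + 1) / (1 - η)) ^ 2 :=
        mul_le_mul_of_nonneg_left hone2 (by positivity)
      _ = _ := by rw [div_pow]; ring

/-! ### Accuracy of the inner loop -/

theorem innerLoop_fst_mem (η : ℝ) (s : Prof N) (hz : z ∈ G.Ωz) :
    (G.innerLoop η γ x y θ z s σ).1 ∈ G.Ωz := iterate_h_mem (warm_mem hz) _

theorem norm_innerLoop_fst_sub_le (hs : G.ConcaveSmooth) (hm : G.StronglyMonotone μ κ)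
    (h0 : 0 < γ) (h1 : γ < 2 * μ / κ ^ 2) (hθ : θ ∈ G.Θ) (hx : x ∈ G.Ωx) (hy : y ∈ G.Ωy)
    (hz : z ∈ G.Ωz) (hσ : 0 < σ) (η : ℝ) :
    ‖(G.innerLoop η γ x y θ z s σ).1 - G.brZ x y θ‖ ≤ σ / (1 - contr μ κ γ) := by
  refine (norm_iterate_sub_brZ_le hs hm h0 hθ hx hy (warm_mem hz) _).trans
    (le_trans ?_ (norm_warm_sub_brZ_le hs hm h0 h1 hθ hx hy hz hσ))
  exact mul_le_of_le_one_left (norm_nonneg _)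
    (pow_le_one₀ (contr_nonneg _ _ _) (contr_lt_one hm h0 h1).le)

theorem innerLoop_snd_mem_tangent (hm : G.StronglyMonotone μ κ) (h0 : 0 < γ)
    (h1 : γ < 2 * μ / κ ^ 2) (hθ : θ ∈ G.Θ) (hx : x ∈ G.Ωx) (hy : y ∈ G.Ωy)
    (hz : z ∈ G.Ωz) (hσ : 0 < σ) :
    (G.innerLoop (contr μ κ γ) γ x y θ z s σ).2 ∈ G.tangent := by
  obtain ⟨hl, -⟩ := Nat.sInf_mem (sensStops_nonempty hm h0 h1 hθ hx hy
    (warm_mem (γ := γ) (x := x) (y := y) (θ := θ) (σ := σ) hz) hσ)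
  obtain ⟨k, hk⟩ : ∃ k, sInf (G.sensStops (contr μ κ γ) γ x y θ (G.warm γ x y θ z σ) σ) = k + 1 :=
    ⟨_ - 1, (Nat.sub_add_cancel hl).symm⟩
  rw [innerLoop]
  simp only [hk]
  exact sens_succ_mem_tangent k

/-- The sensitivity returned by the inner loop approximates the exact one up to a multiple of the
tolerance, provided that the tolerance is below the distance to the regions that are not active. -/
theorem norm_innerLoop_snd_sub_le (hs : G.ConcaveSmooth) (hm : G.StronglyMonotone μ κ) (h0 : 0 < γ)
    (h1 : γ < 2 * μ / κ ^ 2) (hθ : θ ∈ G.Θ) (hx : x ∈ G.Ωx) (hy : y ∈ G.Ωy) (hz : z ∈ G.Ωz)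
    {C R LF : ℝ}
    (hC : ∀ p ∈ G.joint, ‖fderiv ℝ (fun p : ℝ × ℝ × Prof N => G.F p.1 p.2.1 p.2.2 θ) p‖ ≤ C)
    (hC0 : 0 ≤ C) (hLF0 : 0 ≤ LF)
    (hLF : ∀ z ∈ G.Ωz, ∀ z' ∈ G.Ωz,
      ‖deriv (fun x' => G.F x' y z θ) x - deriv (fun x' => G.F x' y z' θ) x‖ ≤ LF * ‖z - z'‖ ∧
      ‖fderiv ℝ (fun w => G.F x y w θ) z - fderiv ℝ (fun w => G.F x y w θ) z'‖ ≤ LF * ‖z - z'‖)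
    (hσ : 0 < σ) {c : Fin N → Fin 3}
    (hball : ∀ w, ‖w - G.omega γ x y θ (G.brZ x y θ)‖ ≤ σ → w ∈ interior (G.region c))
    {t : Prof N} (htT : t ∈ G.tangent) (htR : ‖t‖ ≤ R)
    (htfix : t = deriv (fun x' => G.h γ x' y θ (G.brZ x y θ)) x
      + fderiv ℝ (G.h γ x y θ) (G.brZ x y θ) t)
    (hsT : s ∈ G.tangent) (hsR : ‖s‖ ≤ R) :
    ‖(G.innerLoop (contr μ κ γ) γ x y θ z s σ).2 - t‖
      ≤ (2 * R + γ * LF * (1 + R) / (1 - contr μ κ γ)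
          + 2 * (γ * C + R) / (1 - contr μ κ γ) ^ 2 / (1 - contr μ κ γ)) * σ := by
  have hη1 := contr_lt_one hm h0 h1
  have hη' := sub_pos.2 hη1
  have hR0 : 0 ≤ R := (norm_nonneg _).trans htR
  have hwm := warm_mem (γ := γ) (x := x) (y := y) (θ := θ) (σ := σ) hz
  have hwarm := norm_warm_sub_brZ_le hs hm h0 h1 hθ hx hy hz hσ
  obtain ⟨-, hl⟩ := Nat.sInf_mem (sensStops_nonempty hm h0 h1 hθ hx hy hwm hσ)
  obtain ⟨hl1, hl2⟩ := max_le_iff.1 hl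
  have key := le_mul_of_stop (contr_nonneg μ κ γ) hη1
    (a := γ * LF * (1 + R) / (1 - contr μ κ γ))
    (b := 2 * (γ * C + R) / (1 - contr μ κ γ) ^ 2) (by positivity) (by positivity)
    (e := fun j => ‖G.sens γ x y θ (G.warm γ x y θ z σ) s j - t‖)
    (d := fun j => ‖(G.h γ x y θ)^[j + 1] (G.warm γ x y θ z σ)
      - (G.h γ x y θ)^[j] (G.warm γ x y θ z σ)‖)
    (norm_nonneg _) (fun _ => norm_nonneg _)
    (norm_sens_succ_sub_le hs hm h0 h1 hθ hx hy hwm hC hC0 hLF0 hLF hσ hwarm hball htT htR htfix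
      hsT) hl1 hl2
  refine key.trans (mul_le_mul_of_nonneg_right ?_ hσ.le)
  gcongr
  exact (norm_sub_le _ _).trans ((add_le_add hsR htR).trans_eq (two_mul R).symm)

theorem ball_subset_interior_region {c : Fin N → Fin 3} (hact : G.active γ x θ = {c})
    (hrad : ENNReal.ofReal σ < G.radius γ x θ) (w : Prof N)
    (hw : ‖w - G.omegaStar γ x θ‖ ≤ σ) : w ∈ interior (G.region c) := by
  obtain ⟨r, hr⟩ := lt_iSup_iff.1 hrad
  obtain ⟨hsub, hlt⟩ := lt_iSup_iff.1 hr
  have hlt' : σ < r := by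
    by_contra! hle
    exact absurd hlt (not_lt.2 (by
      rw [← ENNReal.ofReal_coe_nnreal]; exact ENNReal.ofReal_le_ofReal hle))
  rw [hact] at hsub
  simp only [mem_singleton_iff, iUnion_iUnion_eq_left] at hsub
  refine mem_interior.2 ⟨Metric.ball (G.omegaStar γ x θ) r,
    Metric.ball_subset_closedBall.trans hsub, Metric.isOpen_ball, ?_⟩
  rw [Metric.mem_ball, dist_eq_norm]
  exact hw.trans_lt hlt'

/-! ### Convergence on a certainty interval -/

theorem continuousOn_Ured_left (hs : G.ConcaveSmooth) (hm : G.StronglyMonotone μ κ)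
    (hθ : θ ∈ G.Θ) (hy : y ∈ G.Ωy) : ContinuousOn (fun x => G.Ured x y θ) G.Ωx := by
  obtain ⟨C, hC, hlip⟩ := exists_lipschitz_Ured hs hm hθ
  refine (LipschitzOnWith.of_dist_le_mul (K := C.toNNReal) fun x hx x' hx' => ?_).continuousOn
  rw [Real.coe_toNNReal _ hC, Real.dist_eq, Real.dist_eq]
  simpa using hlip x hx y hy x' hx' y hy

theorem continuousOn_Ured_right (hs : G.ConcaveSmooth) (hm : G.StronglyMonotone μ κ)
    (hθ : θ ∈ G.Θ) (hx : x ∈ G.Ωx) : ContinuousOn (fun y => G.Ured x y θ) G.Ωy := by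
  obtain ⟨C, hC, hlip⟩ := exists_lipschitz_Ured hs hm hθ
  refine (LipschitzOnWith.of_dist_le_mul (K := C.toNNReal) fun y hy y' hy' => ?_).continuousOn
  rw [Real.coe_toNNReal _ hC, Real.dist_eq, Real.dist_eq]
  simpa using hlip x hx y hy x hx y' hy'

section Outer

variable {a b : ℝ} {α τ : ℕ → ℝ} {init : State N}

theorem iter_x_mem (η : ℝ) (hba : b ≤ a) (hx : init.x ∈ Icc b a) (k : ℕ) :
    (G.iter η γ θ b a α τ init k).x ∈ Icc b a := by
  cases k with
  | zero => exact hx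
  | succ k => exact clamp_mem hba _

theorem iter_z_mem (η : ℝ) (hz : init.z ∈ G.Ωz) (k : ℕ) :
    (G.iter η γ θ b a α τ init k).z ∈ G.Ωz := by
  induction k with
  | zero => exact hz
  | succ k ih => exact innerLoop_fst_mem η (G.iter η γ θ b a α τ init k).s ih

theorem phi₁_mem : G.phi₁ x θ ∈ G.Ωy := by
  rw [phi₁]
  split_ifs
  · exact ⟨G.hy, le_rfl⟩
  · exact ⟨le_rfl, G.hy⟩

/-- After the first outer step the approximate sensitivities are tangent to the box and bounded. -/
theorem exists_bound_iter_s (hm : G.StronglyMonotone μ κ) (h0 : 0 < γ) (h1 : γ < 2 * μ / κ ^ 2)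
    (hθ : θ ∈ G.Θ) (hba : b ≤ a) (hsub : Icc b a ⊆ G.Ωx) (hix : init.x ∈ Icc b a)
    (hiz : init.z ∈ G.Ωz) (hτ : ∀ k, 0 < τ k) {C : ℝ}
    (hC : ∀ p ∈ G.joint, ‖fderiv ℝ (fun p : ℝ × ℝ × Prof N => G.F p.1 p.2.1 p.2.2 θ) p‖ ≤ C) :
    ∃ R : ℝ, γ * C ≤ (1 - contr μ κ γ) * R ∧ ∀ k,
      (G.iter (contr μ κ γ) γ θ b a α τ init (k + 1)).s ∈ G.tangent ∧
      ‖(G.iter (contr μ κ γ) γ θ b a α τ init (k + 1)).s‖ ≤ R := by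
  have hη' := sub_pos.2 (contr_lt_one hm h0 h1)
  set c := G.iter (contr μ κ γ) γ θ b a α τ init with hc
  have hT : ∀ k, (c (k + 1)).s ∈ G.tangent := fun k =>
    innerLoop_snd_mem_tangent hm h0 h1 hθ (hsub (iter_x_mem _ hba hix k)) phi₁_mem
      (iter_z_mem _ hiz k) (hτ k)
  set R := max ‖(c 1).s‖ (γ * C / (1 - contr μ κ γ)) with hR
  have hCR : γ * C ≤ (1 - contr μ κ γ) * R := by
    have := le_max_right ‖(c 1).s‖ (γ * C / (1 - contr μ κ γ))
    rw [div_le_iff₀ hη'] at this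
    linarith
  refine ⟨R, hCR, fun k => ⟨hT k, ?_⟩⟩
  induction k with
  | zero => exact le_max_left _ _
  | succ k ih =>
    exact norm_sens_le hm h0 hθ (hsub (iter_x_mem _ hba hix _)) phi₁_mem
      (warm_mem (iter_z_mem _ hiz _)) hC hCR (hT k) ih _

/-- On an interval where the middle level always responds with `y`, the outer iterates converge to a
maximizer of the leader's reduced utility: the computed hypergradients are the derivatives of a
concave function, up to errors proportional to the tolerances. -/
theorem exists_tendsto_iter (hs : G.ConcaveSmooth) (hm : G.StronglyMonotone μ κ) (hr : G.Regular)
    (h0 : 0 < γ) (h1 : γ < 2 * μ / κ ^ 2) (hθ : θ ∈ G.Θ) (hy : y ∈ G.Ωy) (hba : b ≤ a)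
    (hsub : Icc b a ⊆ G.Ωx) (hphi : ∀ x ∈ Icc b a, G.phi₁ x θ = y)
    (hconc : ConcaveOn ℝ (Icc b a) fun x => G.Ured x y θ) (hix : init.x ∈ Icc b a)
    (hiz : init.z ∈ G.Ωz) (hα : ∀ k, 0 ≤ α k) (hα1 : ¬ Summable α)
    (hα2 : Summable fun k => α k ^ 2) (hτ : ∀ k, 0 < τ k) (hατ : Summable fun k => α k * τ k)
    (hrad : ∃ k' : ℕ, ∀ k, k' < k → ENNReal.ofReal (τ k)
      < G.radius γ (G.iter (contr μ κ γ) γ θ b a α τ init k).x θ)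
    (hsing : {k : ℕ | ¬ ∃ c, G.active γ (G.iter (contr μ κ γ) γ θ b a α τ init k).x θ
      = {c}}.Finite) :
    ∃ v ∈ Icc b a, Tendsto (fun k => (G.iter (contr μ κ γ) γ θ b a α τ init k).x) atTop (𝓝 v) ∧
      IsMaxOn (fun x => G.Ured x y θ) (Icc b a) v := by
  have hη' := sub_pos.2 (contr_lt_one hm h0 h1)
  obtain ⟨C, hC0, hC, -⟩ := exists_bound_F hm hθ
  obtain ⟨LF', hLF'⟩ := hr.F_jacobian
  obtain ⟨CU, hCU0, hCU⟩ := exists_abs_hypergrad_le hs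
  obtain ⟨CH, hCH0, hCH⟩ := exists_lipschitz_hypergrad hs hr
  obtain ⟨R, hCR, hbound⟩ := exists_bound_iter_s (α := α) hm h0 h1 hθ hba hsub hix hiz hτ hC
  obtain ⟨k', hk'⟩ := hrad
  obtain ⟨k'', hk''⟩ := hsing.bddAbove
  set LF := max LF' 0 with hLF
  have hLF0 : 0 ≤ LF := le_max_right _ _
  set η := contr μ κ γ with hη
  set c := G.iter η γ θ b a α τ init with hc
  have hxI : ∀ k, (c k).x ∈ Icc b a := iter_x_mem _ hba hix
  have hx : ∀ k, (c k).x ∈ G.Ωx := fun k => hsub (hxI k)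
  have hz : ∀ k, (c k).z ∈ G.Ωz := iter_z_mem _ hiz
  have hzs : ∀ k, G.brZ (c k).x y θ ∈ G.Ωz := fun k => brZ_mem hs hm hθ (hx k) hy
  have hR0 : 0 ≤ R := (norm_nonneg _).trans (hbound 0).2
  set p : ℕ → Prof N × Prof N :=
    fun k => G.innerLoop η γ (c k).x y θ (c k).z (c k).s (τ k) with hp
  have hcsucc : ∀ k, c (k + 1) = ⟨max b (min a ((c k).x
      + α k * G.hypergrad (c k).x y (p k).1 (p k).2)), (p k).1, (p k).2⟩ := by
    intro k
    have : c (k + 1) = G.step η γ θ b a (α k) (τ k) (c k) := rfl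
    rw [this, step, hphi _ (hxI k)]
  -- from this index on both conditions on the iterates hold and the sensitivities are tangent
  set K := k' + k'' + 1 with hK
  set S := 2 * R + γ * LF * (1 + R) / (1 - η) + 2 * (γ * C + R) / (1 - η) ^ 2 / (1 - η) with hS
  have hS0 : 0 ≤ S := by positivity
  set M := CH * ((1 + R) * (1 / (1 - η)) + S) * (a - b) with hM
  have hM0 : 0 ≤ M := by
    have := sub_nonneg.2 hba
    positivity
  have hgrad : ∀ k, K ≤ k → ∀ u ∈ Icc b a, G.Ured u y θ - G.Ured (c k).x y θ
      ≤ G.hypergrad (c k).x y (p k).1 (p k).2 * (u - (c k).x) + M * τ k := by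
    intro k hk u hu
    obtain ⟨r, hact⟩ : ∃ r, G.active γ (c k).x θ = {r} := by
      by_contra hcon
      have := hk'' hcon
      omega
    have hball := ball_subset_interior_region hact (hk' k (by omega))
    have hom : G.omegaStar γ (c k).x θ
        = G.omega γ (c k).x y θ (G.brZ (c k).x y θ) := by
      rw [omegaStar, hphi _ (hxI k)]
    rw [hom] at hball
    obtain ⟨t, htT, htfix⟩ := exists_sensitivity hm h0 h1 hθ (hx k) hy (hzs k)
    have htR : ‖t‖ ≤ R := by
      have e1 := norm_deriv_h_le hm h0 hθ (hx k) hy (hzs k) hC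
      have e2 := norm_fderiv_h_apply_le hm h0 hθ (hx k) hy (hzs k) htT
      have e3 : ‖t‖ ≤ γ * C + η * ‖t‖ := by
        conv_lhs => rw [htfix]
        exact (norm_add_le _ _).trans (add_le_add e1 e2)
      have e4 : (1 - η) * ‖t‖ ≤ (1 - η) * R := by linarith
      exact le_of_mul_le_mul_left e4 hη'
    have hd := hasDerivWithinAt_Ured hs hm hθ (hx k) hy
      (hasDerivWithinAt_brZ hs hm h0 h1 hθ (hx k) hy
        (hball _ (by simpa using (hτ k).le)) htT htfix)
    have hsup := concaveOn_sub_le_of_hasDerivWithinAt hconc (hxI k) hu (hd.mono hsub)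
    obtain ⟨j, rfl⟩ : ∃ j, k = j + 1 := ⟨k - 1, by omega⟩
    obtain ⟨hsT, hsR⟩ := hbound j
    have herr2 := norm_innerLoop_snd_sub_le hs hm h0 h1 hθ (hx (j + 1)) hy (hz (j + 1)) hC hC0 hLF0
      (fun w hw w' hw' => by
        obtain ⟨q1, q2⟩ := hLF' θ hθ _ (hx (j + 1)) y hy w hw w' hw'
        have q3 := mul_le_mul_of_nonneg_right (le_max_left LF' 0) (norm_nonneg (w - w'))
        exact ⟨q1.trans q3, q2.trans q3⟩)
      (hτ _) hball htT htR htfix hsT hsR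
    have herr1 := norm_innerLoop_fst_sub_le (s := (c (j + 1)).s) hs hm h0 h1 hθ (hx (j + 1)) hy
      (hz (j + 1)) (hτ (j + 1)) η
    have herr := hCH _ (hx (j + 1)) y hy (p (j + 1)).1 (innerLoop_fst_mem _ _ (hz _)) _
      (hzs (j + 1)) (p (j + 1)).2 t
    have herr' : |G.hypergrad (c (j + 1)).x y (p (j + 1)).1 (p (j + 1)).2
        - G.hypergrad (c (j + 1)).x y (G.brZ (c (j + 1)).x y θ) t|
        ≤ CH * ((1 + R) * (1 / (1 - η)) + S) * τ (j + 1) := by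
      refine herr.trans ?_
      rw [mul_assoc]
      refine mul_le_mul_of_nonneg_left ?_ hCH0
      calc _ ≤ (1 + R) * (τ (j + 1) / (1 - η)) + S * τ (j + 1) :=
            add_le_add (mul_le_mul (by linarith) herr1 (norm_nonneg _) (by linarith)) herr2
        _ = _ := by ring
    have hdist : |u - (c (j + 1)).x| ≤ a - b := by
      have := hxI (j + 1)
      rw [abs_le]
      constructor <;> linarith [hu.1, hu.2, this.1, this.2]
    have hprod := mul_le_mul herr' hdist (abs_nonneg _) (by have := (hτ (j + 1)).le; positivity)
    rw [← abs_mul] at hprod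
    have hneg := neg_abs_le ((G.hypergrad (c (j + 1)).x y (p (j + 1)).1 (p (j + 1)).2
        - G.hypergrad (c (j + 1)).x y (G.brZ (c (j + 1)).x y θ) t) * (u - (c (j + 1)).x))
    have hMeq : CH * ((1 + R) * (1 / (1 - η)) + S) * τ (j + 1) * (a - b) = M * τ (j + 1) := by
      rw [hM]; ring
    rw [hMeq] at hprod
    linarith
  obtain ⟨v, hv, hlim, hmax⟩ := exists_tendsto_isMaxOn_of_projected_ascent
    (φ := fun x => G.Ured x y θ) (x := fun k => (c (k + K)).x) (α := fun k => α (k + K))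
    (d := fun k => G.hypergrad (c (k + K)).x y (p (k + K)).1 (p (k + K)).2)
    (e := fun k => M * τ (k + K)) (M := CU * (1 + R))
    ((continuousOn_Ured_left hs hm hθ hy).mono hsub) (fun k => hxI _)
    (fun k => by rw [show k + 1 + K = k + K + 1 by ring, hcsucc])
    (fun k => hgrad (k + K) (by omega))
    (fun k => by
      have e1 := hCU _ (hx (k + K)) y hy (p (k + K)).1 (innerLoop_fst_mem _ _ (hz _)) (p (k + K)).2
      have e2 := (hbound (k + K)).2
      rw [hcsucc] at e2
      exact e1.trans (mul_le_mul_of_nonneg_left (by simpa using e2) hCU0))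
    (fun k => mul_nonneg hM0 (hτ _).le) (fun k => hα _)
    (fun h => hα1 ((summable_nat_add_iff K).1 h))
    ((summable_nat_add_iff (f := fun k => α k ^ 2) K).2 hα2)
    (by
      have := ((summable_nat_add_iff (f := fun k => α k * τ k) K).2 hατ).mul_left M
      exact this.congr fun k => by ring)
  exact ⟨v, hv, (tendsto_add_atTop_iff_nat K).1 hlim, hmax⟩

end Outer

/-! ### The middle-level response and the worst-case utilities -/

/-- `f₂(·, θ)` is continuous, being a difference quotient of `U_Y` in `y`. -/
theorem continuousAt_f₂ (hs : G.ConcaveSmooth) (hθ : θ ∈ G.Θ) (hx : x ∈ G.Ωx) :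
    ContinuousAt (fun t => G.f₂ t θ) x := by
  -- `U_Y` is smooth near `(x, ymin)`, so the quotient makes sense even if `Ωy` is a single point
  have h1 : ∀ᶠ p in 𝓝 (x, G.ymin), ContDiffAt ℝ 1 (fun p : ℝ × ℝ => G.UY p.1 p.2 θ) p :=
    (hs.UY_smooth θ hθ x hx G.ymin ⟨le_rfl, G.hy⟩).eventually (by simp)
  have h2 : Tendsto (fun r : ℝ => (x, G.ymin + r)) (𝓝[≠] 0) (𝓝 (x, G.ymin)) := by
    have : Tendsto (fun r : ℝ => (x, G.ymin + r)) (𝓝 0) (𝓝 (x, G.ymin + 0)) := by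
      apply Continuous.tendsto
      fun_prop
    rw [add_zero] at this
    exact this.mono_left nhdsWithin_le_nhds
  obtain ⟨r, hr, hr0⟩ := ((h2.eventually h1).and self_mem_nhdsWithin).exists
  have hr0' : r ≠ 0 := hr0
  have key : ∀ y, ContDiffAt ℝ 1 (fun p : ℝ × ℝ => G.UY p.1 p.2 θ) (x, y) →
      ContinuousAt (fun t => G.UY t y θ) x := fun y hy => by
    have h3 : ContinuousAt (fun t : ℝ => (t, y)) x := by fun_prop
    exact ContinuousAt.comp (g := fun p : ℝ × ℝ => G.UY p.1 p.2 θ) (f := fun t => (t, y))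
      hy.continuousAt h3
  have heq : (fun t => G.f₂ t θ) = fun t => (G.UY t (G.ymin + r) θ - G.UY t G.ymin θ) * r⁻¹ := by
    funext t
    simp only [UY]
    field_simp
    ring
  rw [heq]
  exact ((key _ hr).sub (key _ h1.self_of_nhds)).mul_const _

/-- The middle-level response is constant on intervals without zeros of `f₂(·, θ)`. -/
theorem phi₁_eq (hs : G.ConcaveSmooth) (hθ : θ ∈ G.Θ) {u v : ℝ} (hsub : uIcc u v ⊆ G.Ωx)
    (hne : ∀ t ∈ uIcc u v, G.f₂ t θ ≠ 0) : G.phi₁ u θ = G.phi₁ v θ := by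
  have hc : ContinuousOn (fun t => G.f₂ t θ) (uIcc u v) := fun t ht =>
    (continuousAt_f₂ hs hθ (hsub ht)).continuousWithinAt
  have hivt := intermediate_value_uIcc hc
  have h0 : (0 : ℝ) ∉ uIcc (G.f₂ u θ) (G.f₂ v θ) := fun h => by
    obtain ⟨t, ht, ht0⟩ := hivt h
    exact hne t ht ht0
  rw [mem_uIcc] at h0
  simp only [phi₁]
  push Not at h0
  by_cases hu : 0 < G.f₂ u θ <;> by_cases hv : 0 < G.f₂ v θ
  · rw [if_pos hu, if_pos hv]
  · exact absurd (h0.2 (not_lt.1 hv)) (not_lt.2 hu.le)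
  · exact absurd (h0.1 (not_lt.1 hu)) (not_lt.2 hv.le)
  · rw [if_neg hu, if_neg hv]

theorem mem_BRY_iff : y ∈ G.BRY x θ ↔ y ∈ G.Ωy ∧ ∀ y' ∈ G.Ωy, G.f₂ x θ * y' ≤ G.f₂ x θ * y := by
  simp [BRY, UY]

theorem BRY_of_eq_zero (h : G.f₂ x θ = 0) : G.BRY x θ = G.Ωy := by
  ext y
  simp [mem_BRY_iff, h]

theorem BRY_of_ne_zero (h : G.f₂ x θ ≠ 0) : G.BRY x θ = {G.phi₁ x θ} := by
  ext y
  rw [mem_BRY_iff, mem_singleton_iff, phi₁]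
  rcases h.lt_or_gt with h | h
  · rw [if_neg h.le.not_gt]
    constructor
    · rintro ⟨hy, hmax⟩
      exact le_antisymm ((mul_le_mul_left_of_neg h).1 (hmax _ ⟨le_rfl, G.hy⟩)) hy.1
    · rintro rfl
      exact ⟨⟨le_rfl, G.hy⟩, fun y' hy' => mul_le_mul_of_nonpos_left hy'.1 h.le⟩
  · rw [if_pos h]
    constructor
    · rintro ⟨hy, hmax⟩
      exact le_antisymm hy.2 (le_of_mul_le_mul_left (hmax _ ⟨G.hy, le_rfl⟩) h)
    · rintro rfl
      exact ⟨⟨G.hy, le_rfl⟩, fun y' hy' => mul_le_mul_of_nonneg_left hy'.2 h.le⟩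

theorem isCompact_BRY : IsCompact (G.BRY x θ) ∧ (G.BRY x θ).Nonempty := by
  by_cases h : G.f₂ x θ = 0
  · rw [BRY_of_eq_zero h]
    exact ⟨isCompact_Icc, nonempty_Icc.2 G.hy⟩
  · rw [BRY_of_ne_zero h]
    exact ⟨isCompact_singleton, singleton_nonempty _⟩

theorem worst_eq_sInf (hs : G.ConcaveSmooth) (hm : G.StronglyMonotone μ κ) (hθ : θ ∈ G.Θ)
    (hx : x ∈ G.Ωx) : G.worst x θ = sInf ((fun y => G.Ured x y θ) '' G.BRY x θ) := by
  rw [worst]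
  congr 1
  ext u
  constructor
  · rintro ⟨y, hy, z, hz, rfl⟩
    exact ⟨y, hy, by rw [eq_brZ hs hm hθ hx hy.1 hz]; rfl⟩
  · rintro ⟨y, hy, rfl⟩
    exact ⟨y, hy, _, brZ_mem_BRZ hs hm hθ hx hy.1, rfl⟩

theorem exists_worst (hs : G.ConcaveSmooth) (hm : G.StronglyMonotone μ κ) (hθ : θ ∈ G.Θ)
    (hx : x ∈ G.Ωx) : ∃ y ∈ G.BRY x θ, G.worst x θ = G.Ured x y θ := by
  obtain ⟨y, hy, heq, -⟩ := isCompact_BRY.1.exists_sInf_image_eq_and_le isCompact_BRY.2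
    ((continuousOn_Ured_right hs hm hθ hx).mono fun y hy => hy.1)
  exact ⟨y, hy, (worst_eq_sInf hs hm hθ hx).trans heq⟩

theorem worst_of_ne_zero (hs : G.ConcaveSmooth) (hm : G.StronglyMonotone μ κ) (hθ : θ ∈ G.Θ)
    (hx : x ∈ G.Ωx) (h : G.f₂ x θ ≠ 0) : G.worst x θ = G.Ured x (G.phi₁ x θ) θ := by
  rw [worst_eq_sInf hs hm hθ hx, BRY_of_ne_zero h, image_singleton, csInf_singleton]

theorem worst_of_eq_zero (hs : G.ConcaveSmooth) (hm : G.StronglyMonotone μ κ) (hθ : θ ∈ G.Θ)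
    (hx : x ∈ G.Ωx) (h : G.f₂ x θ = 0) : G.worst x θ = G.g x θ := by
  rw [worst_eq_sInf hs hm hθ hx, BRY_of_eq_zero h, g]

theorem exists_g (hs : G.ConcaveSmooth) (hm : G.StronglyMonotone μ κ) (hθ : θ ∈ G.Θ)
    (hx : x ∈ G.Ωx) :
    ∃ y ∈ G.Ωy, G.g x θ = G.Ured x y θ ∧ ∀ y' ∈ G.Ωy, G.Ured x y θ ≤ G.Ured x y' θ :=
  isCompact_Icc.exists_sInf_image_eq_and_le (nonempty_Icc.2 G.hy)
    (continuousOn_Ured_right hs hm hθ hx)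

theorem g_le (hs : G.ConcaveSmooth) (hm : G.StronglyMonotone μ κ) (hθ : θ ∈ G.Θ)
    (hx : x ∈ G.Ωx) (hy : y ∈ G.Ωy) : G.g x θ ≤ G.Ured x y θ := by
  obtain ⟨y', -, heq, hle⟩ := exists_g hs hm hθ hx
  rw [heq]
  exact hle y hy

theorem g_le_worst (hs : G.ConcaveSmooth) (hm : G.StronglyMonotone μ κ) (hθ : θ ∈ G.Θ)
    (hx : x ∈ G.Ωx) : G.g x θ ≤ G.worst x θ := by
  obtain ⟨y, hy, heq⟩ := exists_worst hs hm hθ hx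
  rw [heq]
  exact g_le hs hm hθ hx hy.1

/-- Once the pessimistic utility is `ε`-optimal, suitable best responses exist. -/
theorem exists_isEpsWDSE (hs : G.ConcaveSmooth) (hm : G.StronglyMonotone μ κ) (hθ : θ ∈ G.Θ)
    (hx : x ∈ G.Ωx) {ε : ℝ} (hopt : ∀ θ' ∈ G.Θ, ∀ x' ∈ G.Ωx, G.worst x' θ' - ε ≤ G.worst x θ) :
    ∃ y z, G.IsEpsWDSE ε x y z θ := by
  obtain ⟨y, hy, heq⟩ := exists_worst hs hm hθ hx
  exact ⟨y, _, hx, hθ, hy, brZ_mem_BRZ hs hm hθ hx hy.1, heq.symm, hopt⟩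

theorem exists_abs_worst_le (hs : G.ConcaveSmooth) (hm : G.StronglyMonotone μ κ) :
    ∃ M : ℝ, 0 ≤ M ∧ ∀ θ ∈ G.Θ, ∀ x ∈ G.Ωx, |G.worst x θ| ≤ M := by
  have hc : ContinuousOn (fun p : ℝ × ℝ × Prof N => G.UX p.1 p.2.1 p.2.2) G.joint := fun p hp =>
    (hs.UX_smooth _ hp.1 _ hp.2.1 _ hp.2.2).continuousAt.continuousWithinAt
  obtain ⟨M, hM⟩ := G.isCompact_joint.exists_bound_of_continuousOn hc
  refine ⟨max M 0, le_max_right _ _, fun θ hθ x hx => ?_⟩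
  obtain ⟨y, hy, heq⟩ := exists_worst hs hm hθ hx
  rw [heq]
  exact (hM _ (mk_mem_joint hx hy.1 (brZ_mem hs hm hθ hx hy.1))).trans (le_max_left _ _)

/-! ### Certainty intervals -/

namespace Enclosure

variable (E : G.Enclosure θ)

/-- The last zero before the `i`-th certainty interval, or `xmin`. -/
noncomputable def prev (i : Fin (E.q + 1)) : ℝ := Fin.cons (α := fun _ => ℝ) G.xmin E.zero i

/-- The first zero after the `i`-th certainty interval, or `xmax`. -/
noncomputable def next (i : Fin (E.q + 1)) : ℝ := Fin.snoc (α := fun _ => ℝ) E.zero G.xmax i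

theorem zero_mem (j : Fin E.q) : E.zero j ∈ G.zeroSet θ := E.range_zero ▸ mem_range_self j

theorem lo_le_hi (j : Fin E.q) : E.lo j ≤ E.hi j := (E.lo_le j).trans (E.le_hi j)

theorem xmin_le_left (i : Fin (E.q + 1)) : G.xmin ≤ E.left i := by
  cases i using Fin.cases with
  | zero => simp [left]
  | succ j =>
    simpa [left] using (E.subset j ⟨E.lo_le_hi j, le_rfl⟩).1

theorem right_le_xmax (i : Fin (E.q + 1)) : E.right i ≤ G.xmax := by
  cases i using Fin.lastCases with
  | last => simp [right]
  | cast j =>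
    simpa [right] using (E.subset j ⟨le_rfl, E.lo_le_hi j⟩).2

theorem Icc_subset (i : Fin (E.q + 1)) : Icc (E.left i) (E.right i) ⊆ G.Ωx :=
  Icc_subset_Icc (E.xmin_le_left i) (E.right_le_xmax i)

theorem prev_le_left (i : Fin (E.q + 1)) : E.prev i ≤ E.left i := by
  cases i using Fin.cases with
  | zero => simp [left, prev]
  | succ j => simpa [left, prev] using E.le_hi j

theorem right_le_next (i : Fin (E.q + 1)) : E.right i ≤ E.next i := by
  cases i using Fin.lastCases with
  | last => simp [right, next]
  | cast j => simpa [right, next] using E.lo_le j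

theorem left_sub_prev_le {w : ℝ} (hw0 : 0 ≤ w) (hw : ∀ j, E.hi j - E.lo j ≤ w)
    (i : Fin (E.q + 1)) : E.left i - E.prev i ≤ w := by
  cases i using Fin.cases with
  | zero => simpa [left, prev] using hw0
  | succ j =>
    have h1 := hw j
    have h2 := E.lo_le j
    simp only [left, prev, Fin.cons_succ]
    linarith

theorem next_sub_right_le {w : ℝ} (hw0 : 0 ≤ w) (hw : ∀ j, E.hi j - E.lo j ≤ w)
    (i : Fin (E.q + 1)) : E.next i - E.right i ≤ w := by
  cases i using Fin.lastCases with
  | last => simpa [right, next] using hw0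
  | cast j =>
    have h1 := hw j
    have h2 := E.le_hi j
    simp only [right, next, Fin.snoc_castSucc]
    linarith

theorem prev_mem (i : Fin (E.q + 1)) : E.prev i ∈ {G.xmin, G.xmax} ∪ G.zeroSet θ := by
  cases i using Fin.cases with
  | zero => simp [prev]
  | succ j => exact Or.inr (by simpa [prev] using E.zero_mem j)

theorem next_mem (i : Fin (E.q + 1)) : E.next i ∈ {G.xmin, G.xmax} ∪ G.zeroSet θ := by
  cases i using Fin.lastCases with
  | last => simp [next]
  | cast j => exact Or.inr (by simpa [next] using E.zero_mem j)

/-- Zeros with index below `i` lie to the left of the `i`-th certainty interval, at a positive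
distance unless it is degenerate. -/
theorem zero_le_prev {i : Fin (E.q + 1)} {j : Fin E.q} (hj : (j : ℕ) < i) :
    E.zero j ≤ E.prev i ∧ (E.left i < E.right i → E.zero j < E.left i) := by
  cases i using Fin.cases with
  | zero => simp at hj
  | succ k =>
    have hjk : E.zero j ≤ E.zero k :=
      E.zero_mono.monotone (Fin.le_def.2 (by simpa [Nat.lt_succ_iff] using hj))
    refine ⟨by simpa [prev] using hjk, fun hlt => ?_⟩
    have hlt' := hlt.trans_le (E.right_le_xmax _)
    simp only [left, Fin.cons_succ] at hlt' ⊢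
    by_cases hk : E.zero k = G.xmax
    · exact absurd (E.le_hi k) (not_le.2 (hk ▸ hlt'))
    · exact hjk.trans_lt (E.lt_hi k hk)

theorem next_le_zero {i : Fin (E.q + 1)} {j : Fin E.q} (hj : (i : ℕ) ≤ j) :
    E.next i ≤ E.zero j ∧ (E.left i < E.right i → E.right i < E.zero j) := by
  cases i using Fin.lastCases with
  | last =>
    have := j.2
    simp at hj
    omega
  | cast k =>
    have hjk : E.zero k ≤ E.zero j := E.zero_mono.monotone (Fin.le_def.2 (by simpa using hj))
    refine ⟨by simpa [next] using hjk, fun hlt => ?_⟩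
    have hlt' := (E.xmin_le_left _).trans_lt hlt
    simp only [right, Fin.snoc_castSucc] at hlt' ⊢
    by_cases hk : E.zero k = G.xmin
    · exact absurd (E.lo_le k) (not_le.2 (hk ▸ hlt'))
    · exact (E.lo_lt k hk).trans_le hjk

theorem ne_zero_of_mem_Ioo {i : Fin (E.q + 1)} {t : ℝ} (ht : t ∈ Ioo (E.prev i) (E.next i))
    (htx : t ∈ G.Ωx) : G.f₂ t θ ≠ 0 := by
  intro h
  obtain ⟨j, rfl⟩ : t ∈ range E.zero := E.range_zero ▸ ⟨htx, h⟩
  rcases lt_or_ge (j : ℕ) i with hj | hj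
  · exact absurd (E.zero_le_prev hj).1 (not_le.2 ht.1)
  · exact absurd (E.next_le_zero hj).1 (not_le.2 ht.2)

theorem ne_zero_of_mem_Icc {i : Fin (E.q + 1)} (hlt : E.left i < E.right i) {t : ℝ}
    (ht : t ∈ Icc (E.left i) (E.right i)) : G.f₂ t θ ≠ 0 := by
  intro h
  obtain ⟨j, rfl⟩ : t ∈ range E.zero := E.range_zero ▸ ⟨E.Icc_subset i ht, h⟩
  rcases lt_or_ge (j : ℕ) i with hj | hj
  · exact absurd ht.1 (not_le.2 ((E.zero_le_prev hj).2 hlt))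
  · exact absurd ht.2 (not_le.2 ((E.next_le_zero hj).2 hlt))

theorem phi₁_eq_left (hs : G.ConcaveSmooth) (hθ : θ ∈ G.Θ) {i : Fin (E.q + 1)}
    (hlt : E.left i < E.right i) {t : ℝ} (ht : t ∈ Icc (E.left i) (E.right i)) :
    G.phi₁ t θ = G.phi₁ (E.left i) θ := by
  have hsub : uIcc t (E.left i) ⊆ Icc (E.left i) (E.right i) :=
    uIcc_subset_Icc ht ⟨le_rfl, hlt.le⟩
  exact phi₁_eq hs hθ (hsub.trans (E.Icc_subset i)) fun u hu => E.ne_zero_of_mem_Icc hlt (hsub hu)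

theorem concaveOn_Ured (hc : G.ReducedConcave) (hθ : θ ∈ G.Θ) (hy : y ∈ G.Ωy)
    {i : Fin (E.q + 1)} (hlt : E.left i < E.right i) :
    ConcaveOn ℝ (Icc (E.left i) (E.right i)) fun x => G.Ured x y θ := by
  have hsub := Icc_subset_Icc (E.prev_le_left i) (E.right_le_next i)
  have hmem : ∀ p ∈ {G.xmin, G.xmax} ∪ G.zeroSet θ, p ∈ G.Ωx := by
    rintro p ((rfl | rfl) | hp)
    · exact ⟨le_rfl, G.hx.le⟩
    · exact ⟨G.hx.le, le_rfl⟩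
    · exact hp.1
  refine (hc θ hθ y hy _ (E.prev_mem i) _ (E.next_mem i)
    ((E.prev_le_left i).trans_lt (hlt.trans_le (E.right_le_next i))) fun t ht => ?_).subset
    hsub (convex_Icc _ _)
  exact E.ne_zero_of_mem_Ioo ht
    ⟨(hmem _ (E.prev_mem i)).1.trans ht.1.le, ht.2.le.trans (hmem _ (E.next_mem i)).2⟩

/-- Every point that is not a zero lies between the two points of `{xmin, xmax} ∪ {zeros}` that
surround some certainty interval. -/
theorem exists_prev_le_le_next (hx : x ∈ G.Ωx) (hne : G.f₂ x θ ≠ 0) :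
    ∃ i, E.prev i ≤ x ∧ x ≤ E.next i ∧ E.prev i < E.next i := by
  classical
  have hex : ∃ n : ℕ, ∀ j : Fin E.q, n ≤ j → x < E.zero j :=
    ⟨E.q, fun j hj => absurd j.2 (not_lt.2 hj)⟩
  have hzero : ∀ j, E.zero j ≠ x := fun j h => hne (h ▸ (E.zero_mem j).2)
  have hspec := Nat.find_spec hex
  have hmin : ∀ k < Nat.find hex, ∀ hk : k < E.q, k + 1 = Nat.find hex → E.zero ⟨k, hk⟩ < x := by
    intro k hk hkq hk1
    have := Nat.find_min hex hk
    push Not at this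
    obtain ⟨j, hj1, hj2⟩ := this
    have hj3 : (j : ℕ) = k := by
      by_contra hcon
      exact absurd (hspec j (by omega)) (not_lt.2 hj2)
    have : (⟨k, hkq⟩ : Fin E.q) = j := Fin.ext hj3.symm
    rw [this]
    exact lt_of_le_of_ne hj2 (hzero j)
  have hle : Nat.find hex ≤ E.q := Nat.find_min' hex fun j hj => absurd j.2 (not_lt.2 hj)
  obtain ⟨i, hi⟩ : ∃ i : Fin (E.q + 1), (i : ℕ) = Nat.find hex := ⟨⟨_, Nat.lt_succ_of_le hle⟩, rfl⟩
  rw [← hi] at hspec hmin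
  have hprev : E.prev i ≤ x ∧ (E.prev i = x → x = G.xmin) := by
    cases i using Fin.cases with
    | zero => exact ⟨by simpa [prev] using hx.1, fun h => by simpa [prev] using h.symm⟩
    | succ j =>
      have h1 : E.zero j < x := hmin j (by simp) j.2 (by simp)
      simp only [prev, Fin.cons_succ]
      exact ⟨h1.le, fun h => absurd h h1.ne⟩
  have hnext : x ≤ E.next i ∧ (E.next i = x → x = G.xmax) := by
    cases i using Fin.lastCases with
    | last => exact ⟨by simpa [next] using hx.2, fun h => by simpa [next] using h.symm⟩
    | cast j =>
      have h1 : x < E.zero j := hspec j (by simp)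
      simp only [next, Fin.snoc_castSucc]
      exact ⟨h1.le, fun h => absurd h h1.ne'⟩
  refine ⟨i, hprev.1, hnext.1, lt_of_le_of_ne (hprev.1.trans hnext.1) fun h => ?_⟩
  have h1 := hprev.2 (le_antisymm hprev.1 (h ▸ hnext.1))
  have h2 := hnext.2 (le_antisymm (h ▸ hprev.1) hnext.1)
  exact G.hx.ne (h1.symm.trans h2)

/-- If the enclosing intervals are short compared with the distances of the zeros, then every point
that is not a zero is close to a point of a certainty interval at which the middle level responds in
the same way. -/
theorem exists_near_certainty (hs : G.ConcaveSmooth) (hθ : θ ∈ G.Θ) {w d : ℝ} (hw0 : 0 ≤ w)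
    (hw : ∀ j, E.hi j - E.lo j ≤ w) (hwd : 2 * w < d)
    (hd : ∀ s ∈ {G.xmin, G.xmax} ∪ G.zeroSet θ, ∀ t ∈ {G.xmin, G.xmax} ∪ G.zeroSet θ,
      s < t → d ≤ t - s) (hx : x ∈ G.Ωx) (hne : G.f₂ x θ ≠ 0) :
    ∃ i, E.left i < E.right i ∧ ∃ x' ∈ Icc (E.left i) (E.right i), |x - x'| ≤ w ∧
      G.phi₁ x θ = G.phi₁ x' θ := by
  obtain ⟨i, h1, h2, h3⟩ := E.exists_prev_le_le_next hx hne
  have h4 := hd _ (E.prev_mem i) _ (E.next_mem i) h3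
  have h5 := E.left_sub_prev_le hw0 hw i
  have h6 := E.next_sub_right_le hw0 hw i
  have h7 := E.prev_le_left i
  have h8 := E.right_le_next i
  have hlt : E.left i < E.right i := by linarith
  refine ⟨i, hlt, ?_⟩
  have hl : E.left i ∈ Icc (E.left i) (E.right i) := ⟨le_rfl, hlt.le⟩
  have hr : E.right i ∈ Icc (E.left i) (E.right i) := ⟨hlt.le, le_rfl⟩
  rcases lt_or_ge x (E.left i) with hxl | hxl
  · refine ⟨E.left i, hl, by rw [abs_le]; constructor <;> linarith, phi₁_eq hs hθ
      (uIcc_subset_Icc hx (E.Icc_subset i hl)) fun t ht => ?_⟩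
    have htx : t ∈ G.Ωx := uIcc_subset_Icc hx (E.Icc_subset i hl) ht
    rw [uIcc_of_le hxl.le] at ht
    rcases ht.1.eq_or_lt with rfl | ht1
    · exact hne
    rcases ht.2.eq_or_lt with rfl | ht2
    · exact E.ne_zero_of_mem_Icc hlt hl
    exact E.ne_zero_of_mem_Ioo ⟨h1.trans_lt ht1, by linarith⟩ htx
  rcases lt_or_ge (E.right i) x with hxr | hxr
  · refine ⟨E.right i, hr, by rw [abs_le]; constructor <;> linarith, phi₁_eq hs hθ
      (uIcc_subset_Icc hx (E.Icc_subset i hr)) fun t ht => ?_⟩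
    have htx : t ∈ G.Ωx := uIcc_subset_Icc hx (E.Icc_subset i hr) ht
    rw [uIcc_of_ge hxr.le] at ht
    rcases ht.2.eq_or_lt with rfl | ht1
    · exact hne
    rcases ht.1.eq_or_lt with rfl | ht2
    · exact E.ne_zero_of_mem_Icc hlt hr
    exact E.ne_zero_of_mem_Ioo ⟨by linarith, ht1.trans_le h2⟩ htx
  · exact ⟨x, ⟨hxl, hxr⟩, by simpa using hw0, rfl⟩

end Enclosure

/-! ### Comparison of the candidates -/

namespace Input

variable {E : G.Enclosures} (A : G.Input E)

theorem candidates_finite (lim : (θ : G.Θ) → Fin ((E θ).q + 1) → ℝ) (θ : G.Θ) :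
    (A.candidates lim θ).Finite := by
  refine ((finite_range fun i =>
      (lim θ i, G.Ured (lim θ i) (G.phi₁ (lim θ i) θ.1) θ.1)).union
    (finite_range fun j => (A.rep θ j, G.g (A.rep θ j) θ.1))).subset ?_
  rintro c (⟨i, -, rfl⟩ | ⟨j, rfl⟩)
  · exact Or.inl ⟨i, rfl⟩
  · exact Or.inr ⟨j, rfl⟩

theorem candidates_nonempty (lim : (θ : G.Θ) → Fin ((E θ).q + 1) → ℝ) (θ : G.Θ) :
    (A.candidates lim θ).Nonempty := by
  rcases Nat.eq_zero_or_pos (E θ).q with hq | hq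
  · refine ⟨_, Or.inl ⟨0, ?_, rfl⟩⟩
    have h0 : (0 : Fin ((E θ).q + 1)) = Fin.last _ := Fin.ext (by simp [hq])
    have h1 : (E θ).left 0 = G.xmin := by simp [Enclosure.left]
    have h2 : (E θ).right 0 = G.xmax := by rw [h0]; simp [Enclosure.right]
    rw [h1, h2]
    exact G.hx
  · exact ⟨_, Or.inr ⟨⟨0, hq⟩, rfl⟩⟩

theorem exists_isOutput (lim : (θ : G.Θ) → Fin ((E θ).q + 1) → ℝ) :
    ∃ U x θ, A.IsOutput lim U x θ := by
  obtain ⟨θ₁, hθ₁⟩ := G.hΘ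
  have hfin : (⋃ θ : G.Θ, A.candidates lim θ).Finite :=
    finite_iUnion fun θ => A.candidates_finite lim θ
  have hne : (⋃ θ : G.Θ, A.candidates lim θ).Nonempty :=
    nonempty_iUnion.2 ⟨⟨θ₁, hθ₁⟩, A.candidates_nonempty lim _⟩
  obtain ⟨⟨x, U⟩, hc, hmax⟩ := Set.exists_max_image _ Prod.snd hfin hne
  obtain ⟨θ, hθ⟩ := mem_iUnion.1 hc
  exact ⟨U, x, θ, hθ, fun θ' c hc' => hmax c (mem_iUnion.2 ⟨θ', hc'⟩)⟩

theorem mem_Ωx_and_le_worst (hs : G.ConcaveSmooth) (hm : G.StronglyMonotone μ κ)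
    (hrep : ∀ (θ : G.Θ) (j : Fin (E θ).q), A.rep θ j ∈ (E θ).I j)
    {lim : (θ : G.Θ) → Fin ((E θ).q + 1) → ℝ}
    (hlim : ∀ (θ : G.Θ) (i : Fin ((E θ).q + 1)), (E θ).left i < (E θ).right i →
      lim θ i ∈ Icc ((E θ).left i) ((E θ).right i))
    {θ : G.Θ} {c : ℝ × ℝ} (hc : c ∈ A.candidates lim θ) :
    c.1 ∈ G.Ωx ∧ c.2 ≤ G.worst c.1 θ.1 := by
  rcases hc with ⟨i, hlt, rfl⟩ | ⟨j, rfl⟩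
  · have hmem := (E θ).Icc_subset i (hlim θ i hlt)
    exact ⟨hmem, (worst_of_ne_zero hs hm θ.2 hmem
      ((E θ).ne_zero_of_mem_Icc hlt (hlim θ i hlt))).ge⟩
  · have hmem := (E θ).subset j (hrep θ j)
    exact ⟨hmem, g_le_worst hs hm θ.2 hmem⟩

/-- The largest recorded utility is, up to the variation of the reduced utility over an enclosing
interval, an upper bound for the pessimistic utility. -/
theorem worst_le_of_isOutput (hs : G.ConcaveSmooth) (hm : G.StronglyMonotone μ κ)
    (hrep : ∀ (θ : G.Θ) (j : Fin (E θ).q), A.rep θ j ∈ (E θ).I j)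
    {lim : (θ : G.Θ) → Fin ((E θ).q + 1) → ℝ}
    (hlim : ∀ (θ : G.Θ) (i : Fin ((E θ).q + 1)), (E θ).left i < (E θ).right i →
      lim θ i ∈ Icc ((E θ).left i) ((E θ).right i))
    (hmax : ∀ (θ : G.Θ) (i : Fin ((E θ).q + 1)), (E θ).left i < (E θ).right i →
      IsMaxOn (fun x => G.Ured x (G.phi₁ ((E θ).left i) θ.1) θ.1)
        (Icc ((E θ).left i) ((E θ).right i)) (lim θ i))
    {K w d : ℝ} (hK0 : 0 ≤ K)
    (hK : ∀ θ ∈ G.Θ, ∀ x ∈ G.Ωx, ∀ y ∈ G.Ωy, ∀ x' ∈ G.Ωx, |G.Ured x y θ - G.Ured x' y θ|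
      ≤ K * |x - x'|)
    (hw0 : 0 ≤ w) (hw : ∀ (θ : G.Θ) j, (E θ).hi j - (E θ).lo j ≤ w) (hwd : 2 * w < d)
    (hd : ∀ θ ∈ G.Θ, ∀ s ∈ {G.xmin, G.xmax} ∪ G.zeroSet θ,
      ∀ t ∈ {G.xmin, G.xmax} ∪ G.zeroSet θ, s < t → d ≤ t - s)
    {U x : ℝ} {θ : G.Θ} (hout : A.IsOutput lim U x θ) {θ' : Par m} (hθ' : θ' ∈ G.Θ) {x' : ℝ}
    (hx' : x' ∈ G.Ωx) : G.worst x' θ' ≤ U + K * w := by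
  by_cases hzero : G.f₂ x' θ' = 0
  · obtain ⟨j, hj⟩ : x' ∈ range (E ⟨θ', hθ'⟩).zero :=
      (E ⟨θ', hθ'⟩).range_zero ▸ ⟨hx', hzero⟩
    have hp := hrep ⟨θ', hθ'⟩ j
    have hU := hout.2 ⟨θ', hθ'⟩ _ (Or.inr ⟨j, rfl⟩)
    have hpx := (E ⟨θ', hθ'⟩).subset j hp
    simp only at hU
    set p := A.rep ⟨θ', hθ'⟩ j
    rw [worst_of_eq_zero hs hm hθ' hx' hzero]
    obtain ⟨y, hy, heq, -⟩ := exists_g hs hm hθ' hpx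
    have h1 := g_le hs hm hθ' hx' hy
    have h2 := (abs_le.1 (hK θ' hθ' x' hx' y hy p hpx)).2
    have h3 : |x' - p| ≤ w := by
      have e1 := (E ⟨θ', hθ'⟩).lo_le j
      have e2 := (E ⟨θ', hθ'⟩).le_hi j
      have e3 := hw ⟨θ', hθ'⟩ j
      rw [← hj, abs_le]
      constructor <;> linarith [hp.1, hp.2]
    have h4 := mul_le_mul_of_nonneg_left h3 hK0
    linarith
  · obtain ⟨i, hlt, x'', hx'', hdist, hphi⟩ := (E ⟨θ', hθ'⟩).exists_near_certainty hs hθ' hw0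
      (hw ⟨θ', hθ'⟩) hwd (hd θ' hθ') hx' hzero
    have hU := hout.2 ⟨θ', hθ'⟩ _ (Or.inl ⟨i, hlt, rfl⟩)
    have hm1 := hmax ⟨θ', hθ'⟩ i hlt hx''
    have hl := hlim ⟨θ', hθ'⟩ i hlt
    simp only [mem_ofPred_eq] at hU hm1
    rw [(E ⟨θ', hθ'⟩).phi₁_eq_left hs hθ' hlt hl] at hU
    rw [(E ⟨θ', hθ'⟩).phi₁_eq_left hs hθ' hlt hx''] at hphi
    rw [worst_of_ne_zero hs hm hθ' hx' hzero, hphi]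
    have h2 := (abs_le.1 (hK θ' hθ' x' hx' _ (phi₁_mem (x := (E ⟨θ', hθ'⟩).left i) (θ := θ')) x''
      ((E ⟨θ', hθ'⟩).Icc_subset i hx''))).2
    have h4 := mul_le_mul_of_nonneg_left hdist hK0
    linarith

end Input

end Game

end Deception

theorem mainTheorem3 {m N : ℕ} (G : Deception.Game m N) (μ κ : ℝ)
    (hsmooth : G.ConcaveSmooth) (hmono : G.StronglyMonotone μ κ) (hreg : G.Regular)
    (hconc : G.ReducedConcave) :
    ∃ L : ℝ, 0 < L ∧ ∀ ε : ℝ, 0 < ε → ∀ E : G.Enclosures,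
      (∀ (θ : G.Θ) (j : Fin (E θ).q),
        MeasureTheory.volume ((E θ).I j) ≤ ENNReal.ofReal (ε / L)) →
      ∀ A : G.Input E, A.Admissible μ κ → A.TolBelowRadius μ κ → A.EventuallySingleton μ κ →
        A.ConvergesToEpsWDSE μ κ ε := by
  open Deception Deception.Game in
  obtain ⟨M, hM0, hM⟩ := exists_abs_worst_le hsmooth hmono
  have hpts : (⋃ θ ∈ G.Θ, ({G.xmin, G.xmax} ∪ G.zeroSet θ)).Finite :=
    G.Θ.finite_toSet.biUnion fun θ hθ => (Set.toFinite _).union (hreg.zeros_finite θ hθ)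
  obtain ⟨d, hd0, hd⟩ := exists_gap hpts
  have hd' : ∀ θ ∈ G.Θ, ∀ s ∈ {G.xmin, G.xmax} ∪ G.zeroSet θ,
      ∀ t ∈ {G.xmin, G.xmax} ∪ G.zeroSet θ, s < t → d ≤ t - s := fun θ hθ s hs t ht =>
    hd s (Set.mem_biUnion hθ hs) t (Set.mem_biUnion hθ ht)
  have hlip : ∀ θ, ∃ C : ℝ, θ ∈ G.Θ → 0 ≤ C ∧ ∀ x ∈ G.Ωx, ∀ y ∈ G.Ωy, ∀ x' ∈ G.Ωx, ∀ y' ∈ G.Ωy,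
      |G.Ured x y θ - G.Ured x' y' θ| ≤ C * max |x - x'| |y - y'| := by
    intro θ
    by_cases hθ : θ ∈ G.Θ
    · obtain ⟨C, hC⟩ := exists_lipschitz_Ured hsmooth hmono hθ
      exact ⟨C, fun _ => hC⟩
    · exact ⟨0, fun h => absurd h hθ⟩
  choose C hC using hlip
  set K := ∑ θ ∈ G.Θ, C θ with hKdef
  have hK0 : 0 ≤ K := Finset.sum_nonneg fun θ hθ => (hC θ hθ).1
  have hK : ∀ θ ∈ G.Θ, ∀ x ∈ G.Ωx, ∀ y ∈ G.Ωy, ∀ x' ∈ G.Ωx,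
      |G.Ured x y θ - G.Ured x' y θ| ≤ K * |x - x'| := fun θ hθ x hx y hy x' hx' => by
    have h1 := (hC θ hθ).2 x hx y hy x' hx' y hy
    rw [sub_self, abs_zero, max_eq_left (abs_nonneg _)] at h1
    refine h1.trans (mul_le_mul_of_nonneg_right ?_ (abs_nonneg _))
    exact Finset.single_le_sum (fun θ hθ => (hC θ hθ).1) hθ
  -- the second term makes `2 * (ε / L) < d` as soon as `ε < 2 * M`
  have hL : 0 < K + 4 * M / d + 1 := by positivity
  refine ⟨K + 4 * M / d + 1, hL, fun ε hε E hE A hA hrad hsing => ?_⟩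
  set L := K + 4 * M / d + 1 with hLdef
  have hy : ∀ (θ : G.Θ) i, G.phi₁ ((E θ).left i) θ.1 ∈ G.Ωy := fun θ i => phi₁_mem
  have hconv : ∀ (θ : G.Θ) (i : Fin ((E θ).q + 1)), ∃ v, (E θ).left i < (E θ).right i →
      v ∈ Set.Icc ((E θ).left i) ((E θ).right i) ∧
      Filter.Tendsto (fun k => (A.run μ κ θ i k).x) Filter.atTop (nhds v) ∧
      IsMaxOn (fun x => G.Ured x (G.phi₁ ((E θ).left i) θ.1) θ.1)
        (Set.Icc ((E θ).left i) ((E θ).right i)) v := by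
    intro θ i
    by_cases hlt : (E θ).left i < (E θ).right i
    · obtain ⟨v, hv⟩ := exists_tendsto_iter hsmooth hmono hreg hA.γ_pos hA.γ_lt θ.2 (hy θ i) hlt.le
        ((E θ).Icc_subset i) (fun x hx => (E θ).phi₁_eq_left hsmooth θ.2 hlt hx)
        ((E θ).concaveOn_Ured hconc θ.2 (hy θ i) hlt) (hA.init_x θ i hlt) (hA.init_z θ i hlt)
        hA.α_nonneg hA.α_not_summable hA.α_sq_summable hA.σ_pos hA.ασ_summable
        (hrad θ i hlt) (hsing θ i hlt)
      exact ⟨v, fun _ => hv⟩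
    · exact ⟨0, fun h => absurd h hlt⟩
  choose lim hlim using hconv
  refine ⟨fun θ i hlt k => innerStops hmono hA.γ_pos hA.γ_lt θ.2
      ((E θ).Icc_subset i (iter_x_mem _ hlt.le (hA.init_x θ i hlt) k)) phi₁_mem
      (iter_z_mem _ (hA.init_z θ i hlt) k) (hA.σ_pos k),
    lim, fun θ i hlt => (hlim θ i hlt).2.1, A.exists_isOutput lim, fun U x θ hout => ?_⟩
  obtain ⟨hxΩ, hU⟩ := A.mem_Ωx_and_le_worst hsmooth hmono hA.rep_mem
    (fun θ i hlt => (hlim θ i hlt).1) hout.1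
  refine exists_isEpsWDSE hsmooth hmono θ.2 hxΩ fun θ' hθ' x' hx' => ?_
  rcases le_or_gt (2 * M) ε with hbig | hsmall
  · have h1 := (abs_le.1 (hM θ' hθ' x' hx')).2
    have h2 := (abs_le.1 (hM θ.1 θ.2 x hxΩ)).1
    linarith
  · have hw : ∀ (θ : G.Θ) j, (E θ).hi j - (E θ).lo j ≤ ε / L := fun θ j => by
      have h1 := hE θ j
      rwa [Enclosure.I, Real.volume_Icc, ENNReal.ofReal_le_ofReal_iff (by positivity)] at h1
    have hwd : 2 * (ε / L) < d := by
      have h1 : 4 * M < d * L := by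
        have h2 : d * L = d * K + 4 * M + d := by
          rw [hLdef]
          field_simp
        nlinarith [mul_nonneg hd0.le hK0]
      rw [← mul_div_assoc, div_lt_iff₀ hL]
      linarith
    have h1 := A.worst_le_of_isOutput hsmooth hmono hA.rep_mem
      (fun θ i hlt => (hlim θ i hlt).1) (fun θ i hlt => (hlim θ i hlt).2.2) hK0 hK
      (by positivity) hw hwd hd' hout hθ' hx'
    have h2 : K * (ε / L) ≤ ε := by
      rw [← mul_div_assoc, div_le_iff₀ hL, mul_comm]
      refine mul_le_mul_of_nonneg_left ?_ hε.le
      have : 0 ≤ 4 * M / d := by positivity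
      linarith
    linarith
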